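/- Let $T>0$ and let $(\Omega,\mathcal F,\mathbb P)$ be a probability space carrying two independent homogeneous Poisson processes $N^1,N^2$ with intensities $\mu_1,\mu_2>0$; let $(\mathcal F_t)$ be the filtration generated by these two processes. Let $\lambda_1,\lambda_2>0$ be constants. The Poisson betting model consists of the three assets, traded on $[0,T]$, $$B_t=1,\qquad S^1_t=N^1_t+\lambda_1(T-t),\qquad S^2_t=N^2_t+\lambda_2(T-t).$$ A trading strategy is an $(\mathcal F_t)$-predictable vector process $\phi=(\phi^0,\phi^1,\phi^2)$ with $\int_0^T|\phi^i_s|\,ds<\infty$ almost surely for $i=0,1,2$; its value process is $V^\phi_t=\phi^0_tB_t+\phi^1_tS^1_t+\phi^2_tS^2_t$, and its gain up to time $t$ is $V^\phi_t-V^\phi_0$. It is self-financing if, almost surely, for all $t\in[0,T]$, $$V^\phi_t=V^\phi_0+\int_0^t\phi^1_s\,dS^1_s+\int_0^t\phi^2_s\,dS^2_s,$$ where the integrals are pathwise Lebesgue--Stieltjes integrals over $(0,t]$. **Theorem.** (i) The model is arbitrage-free: there are no self-financing strategy $\phi$, time $t\in[0,T]$ and constant $c$ such that $V^\phi_s-V^\phi_0\ge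 -c$ almost surely for every $s\in[0,t]$, $\mathbb P[V^\phi_t-V^\phi_0\ge 0]=1$ and $\mathbb P[V^\phi_t-V^\phi_0>0]>0$. In particular, no self-financing strategy has a gain that is almost surely nonnegative at every time of $[0,T]$ and positive with positive probability at some time. (ii) The model is complete: for every $\mathcal F_T$-measurable random variable $X_T$ (a bet) there is a self-financing strategy $\phi$ in $B,S^1,S^2$ with $X_T=V^\phi_T$ almost surely. -/

import Mathlib

open MeasureTheory ProbabilityTheory Set
open scoped NNReal ENNReal

noncomputable section

/-- `N` is a (homogeneous) Poisson process of intensity `r` under `P`: a counting process started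
at `0`, with nondecreasing right-continuous paths, independent increments, and increments over
`(s, t]` of Poisson law with mean `r * (t - s)`. -/
structure IsPoissonProcess {Ω : Type*} [MeasurableSpace Ω] (N : ℝ≥0 → Ω → ℕ) (r : ℝ≥0)
    (P : Measure Ω) : Prop where
  measurable : ∀ t, Measurable (N t)
  start : ∀ ω, N 0 ω = 0
  monotone : ∀ ω, Monotone fun t => N t ω
  rightContinuous : ∀ ω t, ContinuousWithinAt (fun s => N s ω) (Ici t) t
  indepIncrements : HasIndepIncrements N P
  law_increment : ∀ s t, s ≤ t → P.map (fun ω => N t ω - N s ω) = poissonMeasure (r * (t - s))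

/-- Lebesgue measure on the time axis `[0, ∞)`. -/
def lebesgueTime : Measure ℝ≥0 := (volume : Measure ℝ).comap ((↑) : ℝ≥0 → ℝ)

/-- The in-play betting model on the probability space `(Ω, P)`: the game lasts from time `0` to
time `T`, the goals of the two teams are independent Poisson processes `N 0`, `N 1` of intensities
`μ 0`, `μ 1`, and `lam 0`, `lam 1` are the constants in the dynamics of the two risky assets. -/
structure BettingModel {Ω : Type*} [MeasurableSpace Ω] (P : Measure Ω) where
  T : ℝ≥0
  T_pos : 0 < T
  μ : Fin 2 → ℝ≥0
  μ_pos : ∀ i, 0 < μ i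
  lam : Fin 2 → ℝ
  lam_pos : ∀ i, 0 < lam i
  N : Fin 2 → ℝ≥0 → Ω → ℕ
  isPoisson : ∀ i, IsPoissonProcess (N i) (μ i) P
  indep : IndepFun (fun ω t => N 0 t ω) (fun ω t => N 1 t ω) P

namespace BettingModel

variable {Ω : Type*} [MeasurableSpace Ω] {P : Measure Ω}

/-- The filtration generated by the two goal processes. -/
def filtration (M : BettingModel P) : Filtration ℝ≥0 ‹MeasurableSpace Ω› :=
  Filtration.natural (fun t ω => (M.N 0 t ω, M.N 1 t ω)) fun t =>
    (((M.isPoisson 0).measurable t).prodMk ((M.isPoisson 1).measurable t)).stronglyMeasurable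

/-- The price of the bond, which bears no interest. -/
def bond (_M : BettingModel P) (_t : ℝ≥0) (_ω : Ω) : ℝ := 1

/-- The price of the risky asset `i`: `S^i_t = N^i_t + lam_i (T - t)`. -/
def asset (M : BettingModel P) (i : Fin 2) (t : ℝ≥0) (ω : Ω) : ℝ :=
  M.N i t ω + M.lam i * ((M.T : ℝ) - t)

/-- The path of the goal process `i`, as a nondecreasing right-continuous function of time. -/
def path (M : BettingModel P) (i : Fin 2) (ω : Ω) : StieltjesFunction ℝ≥0 where
  toFun t := M.N i t ω
  mono' := fun _ _ h => Nat.cast_le.mpr ((M.isPoisson i).monotone ω h)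
  right_continuous' := fun t =>
    (continuous_of_discreteTopology (f := ((↑) : ℕ → ℝ))).continuousAt.comp_continuousWithinAt
      ((M.isPoisson i).rightContinuous ω t)

/-- The pathwise Lebesgue-Stieltjes integral of `f` over `(0, t]` against the asset price `S^i`.
The path of `S^i` has finite variation, with `dS^i = dN^i - lam_i dt`. -/
def assetIntegral (M : BettingModel P) (i : Fin 2) (f : ℝ≥0 → ℝ) (t : ℝ≥0) (ω : Ω) : ℝ :=
  (∫ s in Ioc 0 t, f s ∂(M.path i ω).measure) - M.lam i * ∫ s in Ioc 0 t, f s ∂lebesgueTime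

/-- A trading strategy `φ = (φ 0, φ 1, φ 2)` (units of the bond and of the two risky assets):
a predictable vector process with almost surely integrable paths on `[0, T]`. -/
structure IsTradingStrategy (M : BettingModel P) (φ : Fin 3 → ℝ≥0 → Ω → ℝ) : Prop where
  predictable : ∀ i, IsStronglyPredictable M.filtration (φ i)
  integrable : ∀ i, ∀ᵐ ω ∂P, IntegrableOn (fun s => φ i s ω) (Icc 0 M.T) lebesgueTime

/-- The value process `V_t = φ^0_t B_t + φ^1_t S^1_t + φ^2_t S^2_t`. -/
def value (M : BettingModel P) (φ : Fin 3 → ℝ≥0 → Ω → ℝ) (t : ℝ≥0) (ω : Ω) : ℝ :=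
  φ 0 t ω * M.bond t ω + φ 1 t ω * M.asset 0 t ω + φ 2 t ω * M.asset 1 t ω

/-- A trading strategy is self-financing if, almost surely, for all `t` in `[0, T]`,
`V_t = V_0 + ∫_0^t φ^1 dS^1 + ∫_0^t φ^2 dS^2`. -/
structure IsSelfFinancing (M : BettingModel P) (φ : Fin 3 → ℝ≥0 → Ω → ℝ) : Prop
    extends M.IsTradingStrategy φ where
  value_eq : ∀ᵐ ω ∂P, ∀ t ≤ M.T, M.value φ t ω = M.value φ 0 ω +
    M.assetIntegral 0 (fun s => φ 1 s ω) t ω + M.assetIntegral 1 (fun s => φ 2 s ω) t ω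

/-- The gain `V_t - V_0` of a strategy up to time `t`. -/
def gain (M : BettingModel P) (φ : Fin 3 → ℝ≥0 → Ω → ℝ) (t : ℝ≥0) (ω : Ω) : ℝ :=
  M.value φ t ω - M.value φ 0 ω

/-- The model is arbitrage-free: there are no self-financing strategy and no time `t` in `[0, T]`
such that the gain at time `t` is almost surely nonnegative and positive with positive probability,
the gain up to time `t` being bounded below by a constant `-c`. The strategies whose gain is
nonnegative at all times are covered by `c = 0`. Without such a bound,
resetting the stake after each goal one could gain `1` almost surely at time `T`. -/
def IsArbitrageFree (M : BettingModel P) : Prop :=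
  ¬ ∃ φ : Fin 3 → ℝ≥0 → Ω → ℝ, M.IsSelfFinancing φ ∧ ∃ t ≤ M.T,
    (∃ c : ℝ, ∀ s ≤ t, ∀ᵐ ω ∂P, -c ≤ M.gain φ s ω) ∧
    P {ω | 0 ≤ M.gain φ t ω} = 1 ∧ 0 < P {ω | 0 < M.gain φ t ω}

/-- The model is complete: every bet, that is every random variable `X` measurable with respect to
`F_T`, is almost surely the terminal value of a self-financing strategy. -/
def IsComplete (M : BettingModel P) : Prop :=
  ∀ X : Ω → ℝ, Measurable[M.filtration M.T] X →
    ∃ φ : Fin 3 → ℝ≥0 → Ω → ℝ, M.IsSelfFinancing φ ∧ ∀ᵐ ω ∂P, X ω = M.value φ M.T ω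

end BettingModel

end

/-! Absence of arbitrage comes from an equivalent measure. Weighting `P` by the product over `i` of
`(lam i / μ i) ^ N i T * exp (-(lam i - μ i) * T)` gives a probability `pricingMeasure`, called Q
below, under which goals of team `i` arrive at rate `lam i`. By `trim_jumpMeasure`, the measures `dQ
dN^i` and `lam i dQ dt` then agree on the predictable σ-algebra: they agree on the generators `(a,
∞) × A` with `A` in `F_a`, which is the mean of an increment weighted by an event of its past. Hence
a predictable integrand that is `dQ dt`-integrable has an integral of Q-mean zero against each asset
(`integral_pricingMeasure_eq`).

A general strategy is only pathwise integrable. It is cut off once the running integral of `|φ 1| +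
|φ 2|` exceeds `n` (`exists_localization`), so the truncated gains have Q-mean zero. Truncation
amounts to evaluating the gain at a random time, so the lower bound must hold at all times at once
on almost every path (`ae_forall_le`). Fatou's lemma then gives Q-mean at most zero for the gain
itself, and a nonnegative gain vanishes almost surely.

Completeness needs no martingale representation, because replicating strategies need not be bounded
below. Along a grid increasing to `T`, only the first risky asset is used: over each interval the
stake is such that, if team `0` does not score there, the portfolio moves to the value the bet would
have with no further goals at all. Almost surely no goal falls in some last stretch before `T`
(`ae_exists_forall_N_eq`), so the portfolio value is eventually the bet and the stakes are
eventually zero. The initial capital is always zero. -/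

noncomputable section

/-! ### Independence of increments and computations with Poisson laws. -/

variable {Ω : Type*} [MeasurableSpace Ω] {P : Measure Ω}

/-- Every finite set of times before `a` is visited by a monotone sequence that starts at `0`,
and later jumps from `a` to `b`. -/
lemma exists_monotone_seq_of_finset {a b : ℝ≥0} (hab : a ≤ b) (s : Finset ℝ≥0)
    (hs : ∀ x ∈ s, x ≤ a) :
    ∃ (t : ℕ → ℝ≥0) (n : ℕ), Monotone t ∧ t 0 = 0 ∧ t n = a ∧ t (n + 1) = b ∧
      ∀ x ∈ s, ∃ k ≤ n, t k = x := by
  set m := s.card with hm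
  let e := s.orderEmbOfFin hm.symm
  -- Index `0` is time `0`, indices `1, …, m` enumerate `s`, index `m + 1` is `a`, and everything
  -- later is `b`.
  let t : ℕ → ℝ≥0
    | 0 => 0
    | k + 1 => if h : k < m then e ⟨k, h⟩ else if k = m then a else b
  have hle (k : ℕ) (h : k < m) : e ⟨k, h⟩ ≤ a := hs _ (s.orderEmbOfFin_mem _ _)
  refine ⟨t, m + 1, monotone_nat_of_le_succ ?_, rfl, by simp [t], by simp [t], ?_⟩
  · rintro (_ | k)
    · exact zero_le
    · simp only [t]
      by_cases h : k + 1 < m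
      · rw [dif_pos h, dif_pos (by omega)]
        exact e.monotone (by simp [Fin.le_def])
      · rw [dif_neg h]
        by_cases h' : k < m
        · rw [dif_pos h']
          split_ifs
          · exact hle _ _
          · exact (hle _ _).trans hab
        · rw [dif_neg h', if_neg (show ¬ k + 1 = m by omega)]
          split_ifs
          · exact hab
          · exact le_rfl
  · intro x hx
    have : x ∈ Set.range e := by rw [Finset.range_orderEmbOfFin]; exact hx
    obtain ⟨i, rfl⟩ := this
    exact ⟨i + 1, by omega, by simp [t]⟩

/-- The past of a Poisson process up to time `a` is independent of its increment over `(a, b]`. -/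
lemma IsPoissonProcess.indepFun_past_increment [IsProbabilityMeasure P] {N : ℝ≥0 → Ω → ℕ}
    {r : ℝ≥0} (hN : IsPoissonProcess N r P) {a b : ℝ≥0} (hab : a ≤ b) :
    IndepFun (fun ω (u : Iic a) => N u ω) (fun ω => N b ω - N a ω) P := by
  refine IndepFun.process_indepFun (fun u => hN.measurable u)
    (.comp (measurable_of_countable fun x : ℕ × ℕ => x.1 - x.2)
      ((hN.measurable b).prodMk (hN.measurable a))) fun I => ?_
  classical
  obtain ⟨t, n, ht, t0, tn, tn1, hI⟩ := exists_monotone_seq_of_finset hab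
    (I.image Subtype.val) (by simp +contextual)
  have hm (i : ℕ) : Measurable fun ω => N (t (i + 1)) ω - N (t i) ω :=
    .comp (measurable_of_countable fun x : ℕ × ℕ => x.1 - x.2)
      ((hN.measurable _).prodMk (hN.measurable _))
  -- The increments up to `a` are the ones with index below `n`; the increment over `(a, b]` is the
  -- one with index `n`.
  have key := (hN.indepIncrements.nat ht).indepFun_finset (Finset.range n) {n} (by simp) hm
  have hk (i : I) : ∃ k ≤ n, t k = i := hI i (Finset.mem_image_of_mem _ i.2)
  choose k hkn hk using hk
  -- Since the process starts at `0`, its values at the times of `I` are partial sums of increments.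
  let f : (Finset.range n → ℕ) → (I → ℕ) := fun x i =>
    ∑ j : Finset.range n, if (j : ℕ) < k i then x j else 0
  let g : ((({n} : Finset ℕ) : Type) → ℕ) → ℕ := fun x => x ⟨n, by simp⟩
  have hf : Measurable f := by
    refine measurable_pi_lambda _ fun i => Finset.measurable_sum _ fun j _ => ?_
    split_ifs
    · exact measurable_pi_apply j
    · exact measurable_const
  convert! key.comp hf (measurable_pi_apply _ : Measurable g) using 1
  · ext ω i
    have hmono : Monotone fun j => N (t j) ω := (hN.monotone ω).comp ht
    simp only [f, Function.comp]
    rw [Finset.sum_coe_sort (Finset.range n)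
      (fun j => if j < k i then N (t (j + 1)) ω - N (t j) ω else 0), ← Finset.sum_filter]
    have : (Finset.range n).filter (· < k i) = Finset.range (k i) := by
      ext j; have := hkn i; simp; omega
    rw [this, Finset.sum_range_tsub hmono, t0, hN.start, hk, Nat.sub_zero]
  · ext ω
    simp [tn, tn1]

/-- On rectangles the joint probability splits first between the indices `0` and `1`, then between
`X` and `D`; regrouping the four factors gives the claim. It combines independence of the two teams
with independence of past and future for each team. -/
lemma ProbabilityTheory.IndepFun.prodMk_prodMk [IsProbabilityMeasure P]
    {α₀ α₁ β₀ β₁ : Type*} [MeasurableSpace α₀] [MeasurableSpace α₁] [MeasurableSpace β₀]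
    [MeasurableSpace β₁] {X₀ : Ω → α₀} {X₁ : Ω → α₁} {D₀ : Ω → β₀} {D₁ : Ω → β₁}
    (mX₀ : Measurable X₀) (mX₁ : Measurable X₁) (mD₀ : Measurable D₀) (mD₁ : Measurable D₁)
    (h : IndepFun (fun ω => (X₀ ω, D₀ ω)) (fun ω => (X₁ ω, D₁ ω)) P)
    (h₀ : IndepFun X₀ D₀ P) (h₁ : IndepFun X₁ D₁ P) :
    IndepFun (fun ω => (X₀ ω, X₁ ω)) (fun ω => (D₀ ω, D₁ ω)) P := by
  rw [IndepFun_iff_Indep]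
  refine IndepSets.indep (mX₀.prodMk mX₁).comap_le (mD₀.prodMk mD₁).comap_le
    (isPiSystem_prod.comap _) (isPiSystem_prod.comap _) 
    (by rw [← generateFrom_prod, MeasurableSpace.comap_generateFrom]; rfl)
    (by rw [← generateFrom_prod, MeasurableSpace.comap_generateFrom]; rfl) ?_
  rw [IndepSets_iff]
  rintro _ _ ⟨_, ⟨A, hA, B, hB, rfl⟩, rfl⟩ ⟨_, ⟨C, hC, D, hD, rfl⟩, rfl⟩
  simp only [mem_ofPred_eq] at hA hB hC hD
  rw [indepFun_iff_measure_inter_preimage_eq_mul] at h h₀ h₁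
  have e1 := h (A ×ˢ C) (B ×ˢ D) (hA.prod hC) (hB.prod hD)
  simp only [mk_preimage_prod] at e1 ⊢
  have hX : P (X₀ ⁻¹' A ∩ X₁ ⁻¹' B) = P (X₀ ⁻¹' A) * P (X₁ ⁻¹' B) := by
    simpa [mk_preimage_prod] using h (A ×ˢ univ) (B ×ˢ univ) (hA.prod .univ) (hB.prod .univ)
  have hD' : P (D₀ ⁻¹' C ∩ D₁ ⁻¹' D) = P (D₀ ⁻¹' C) * P (D₁ ⁻¹' D) := by
    simpa [mk_preimage_prod] using h (univ ×ˢ C) (univ ×ˢ D) (.prod .univ hC) (.prod .univ hD)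
  rw [inter_inter_inter_comm, e1, h₀ A C hA hC, h₁ B D hB hD, hX, hD', mul_mul_mul_comm]

/-- Reweighting a Poisson law by a power multiplies its parameter. -/
lemma lintegral_poissonMeasure_mul_pow {ρ : ℝ} (hρ : 0 ≤ ρ) (r s : ℝ≥0) (hs : (s : ℝ) = ρ * r)
    (f : ℕ → ℝ≥0∞) :
    ∫⁻ n, f n * ENNReal.ofReal (ρ ^ n * Real.exp (-(s - r))) ∂poissonMeasure r
      = ∫⁻ n, f n ∂poissonMeasure s := by
  rw [lintegral_countable', lintegral_countable']
  refine tsum_congr fun n => ?_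
  rw [poissonMeasure_singleton, poissonMeasure_singleton, mul_assoc,
    ← ENNReal.ofReal_mul (by positivity)]
  congr 2
  rw [hs, mul_pow, neg_sub, Real.exp_sub, Real.exp_neg, Real.exp_neg]
  field_simp

/-- Size biasing shifts the Poisson law: `(n + 1) p(n + 1) = r p(n)`. -/
lemma lintegral_poissonMeasure_id (r : ℝ≥0) :
    ∫⁻ n : ℕ, (n : ℝ≥0∞) ∂poissonMeasure r = r := by
  rw [lintegral_countable', tsum_eq_zero_add' ENNReal.summable]
  have (n : ℕ) : ((n + 1 : ℕ) : ℝ≥0∞) * poissonMeasure r {n + 1}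
      = r * poissonMeasure r {n} := by
    rw [poissonMeasure_singleton, poissonMeasure_singleton, ← ENNReal.ofReal_coe_nnreal (p := r),
      ← ENNReal.ofReal_natCast, ← ENNReal.ofReal_mul (by positivity),
      ← ENNReal.ofReal_mul (by positivity), Nat.factorial_succ]
    congr 1
    push_cast
    field_simp
    ring
  simp_rw [this, ENNReal.tsum_mul_left]
  have : ∑' n, poissonMeasure r {n} = 1 := by
    simpa using (lintegral_countable' (μ := poissonMeasure r) (fun _ => 1)).symm
  simp [this]

end

/-! ### The change of measure and the laws of the goals under it. -/

noncomputable section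

namespace BettingModel

variable {Ω : Type*} [MeasurableSpace Ω] {P : Measure Ω} (M : BettingModel P)

lemma measurable_N (i : Fin 2) {s t : ℝ≥0} (h : s ≤ t) : Measurable[M.filtration t] (M.N i s) := by
  have : Measurable[M.filtration t] fun ω => (M.N 0 s ω, M.N 1 s ω) :=
    Measurable.of_comap_le (le_iSup₂_of_le s h le_rfl)
  fin_cases i
  · exact measurable_fst.comp this
  · exact measurable_snd.comp this

lemma filtration_eq_comap (t : ℝ≥0) : M.filtration t = MeasurableSpace.comap
    (fun ω (u : Iic t) => (M.N 0 u ω, M.N 1 u ω)) inferInstance := by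
  rw [filtration, Filtration.natural_eq_comap]

/-- The likelihood ratio that changes the intensities `μ i` into `lam i`. -/
def density (t : ℝ≥0) (ω : Ω) : ℝ≥0∞ :=
  ∏ i, ENNReal.ofReal ((M.lam i / M.μ i) ^ M.N i t ω * Real.exp (-(M.lam i * t - M.μ i * t)))

lemma measurable_density (t : ℝ≥0) : Measurable[M.filtration t] (M.density t) := by
  refine Finset.measurable_fun_prod _ fun i _ => ?_
  exact (measurable_of_countable fun n : ℕ => ENNReal.ofReal ((M.lam i / M.μ i : ℝ) ^ n *
    Real.exp (-(M.lam i * t - M.μ i * t)))).comp (M.measurable_N i le_rfl)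

lemma density_pos (t : ℝ≥0) (ω : Ω) : M.density t ω ≠ 0 := by
  refine Finset.prod_ne_zero_iff.2 fun i _ => ?_
  have := M.lam_pos i
  have : (0 : ℝ) < M.μ i := M.μ_pos i
  simp only [ne_eq, ENNReal.ofReal_eq_zero, not_le]
  positivity

/-- The exponents are additive in time, so the factor over `(s, t]` involves only the increments
there. It is written in the form of the weight in `lintegral_poissonMeasure_mul_pow`. -/
lemma density_mul {s t : ℝ≥0} (h : s ≤ t) (ω : Ω) : M.density t ω = M.density s ω *
    ∏ i, ENNReal.ofReal ((M.lam i / M.μ i) ^ (M.N i t ω - M.N i s ω) *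
      Real.exp (-((M.lam i).toNNReal * (t - s) - M.μ i * (t - s) : ℝ))) := by
  rw [density, density, ← Finset.prod_mul_distrib]
  refine Finset.prod_congr rfl fun i _ => ?_
  have h1 := M.lam_pos i
  have h2 : (0 : ℝ) < M.μ i := M.μ_pos i
  rw [← ENNReal.ofReal_mul (by positivity), mul_mul_mul_comm, ← pow_add, ← Real.exp_add,
    Nat.add_sub_cancel' ((M.isPoisson i).monotone ω h), Real.coe_toNNReal _ h1.le]
  congr 3
  ring

/-- The measure under which the goal processes have intensities `lam i`. -/
def pricingMeasure : Measure Ω := P.withDensity (M.density M.T)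

lemma pricingMeasure_ac : M.pricingMeasure ≪ P := withDensity_absolutelyContinuous _ _

lemma ac_pricingMeasure : P ≪ M.pricingMeasure :=
  withDensity_absolutelyContinuous' 
    ((M.measurable_density _).mono (M.filtration.le _) le_rfl).aemeasurable
    (.of_forall fun ω => M.density_pos _ ω)

variable [IsProbabilityMeasure P]

/-- The increments of the two goal processes after time `a` are independent of each other and of
the past up to time `a`. -/
lemma lintegral_mul_increments {a b : ℝ≥0} (hab : a ≤ b) {U : Ω → ℝ≥0∞}
    (hU : Measurable[M.filtration a] U) (f g : ℕ → ℝ≥0∞) :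
    ∫⁻ ω, U ω * (f (M.N 0 b ω - M.N 0 a ω) * g (M.N 1 b ω - M.N 1 a ω)) ∂P
      = (∫⁻ ω, U ω ∂P) * ((∫⁻ n, f n ∂poissonMeasure (M.μ 0 * (b - a)))
          * ∫⁻ n, g n ∂poissonMeasure (M.μ 1 * (b - a))) := by
  have mN i t : Measurable (M.N i t) := (M.isPoisson i).measurable t
  let X (i : Fin 2) (ω : Ω) (u : Iic a) : ℕ := M.N i u ω
  let D (i : Fin 2) (ω : Ω) : ℕ := M.N i b ω - M.N i a ω
  have mX i : Measurable (X i) := measurable_pi_lambda _ fun u => mN i u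
  have mD i : Measurable (D i) :=
    .comp (measurable_of_countable fun x : ℕ × ℕ => x.1 - x.2) ((mN i b).prodMk (mN i a))
  have mφ : Measurable fun x : ℝ≥0 → ℕ => ((fun u : Iic a => x u), x b - x a) := by
    have h : Measurable fun x : ℝ≥0 → ℕ => (x b, x a) := by fun_prop
    exact .prodMk (by fun_prop) ((measurable_of_countable fun x : ℕ × ℕ => x.1 - x.2).comp h)
  have hind := M.indep.comp mφ mφ
  have hXD i : IndepFun (X i) (D i) P := (M.isPoisson i).indepFun_past_increment hab
  have key := hind.prodMk_prodMk (mX 0) (mX 1) (mD 0) (mD 1) (hXD 0) (hXD 1)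
  have hD : IndepFun (D 0) (D 1) P := hind.comp measurable_snd measurable_snd
  have hlaw i (f : ℕ → ℝ≥0∞) :
      ∫⁻ ω, f (D i ω) ∂P = ∫⁻ n, f n ∂poissonMeasure (M.μ i * (b - a)) := by
    rw [← (M.isPoisson i).law_increment a b hab, lintegral_map (measurable_of_countable _) (mD i)]
  rw [filtration_eq_comap] at hU
  obtain ⟨V, mV, rfl⟩ := hU.exists_eq_measurable_comp
  let V' : (Iic a → ℕ) × (Iic a → ℕ) → ℝ≥0∞ := fun x => V fun u => (x.1 u, x.2 u)
  have mV' : Measurable V' := mV.comp (by fun_prop)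
  have mfg : Measurable fun x : ℕ × ℕ => f x.1 * g x.2 := measurable_of_countable _
  have e1 := lintegral_mul_eq_lintegral_mul_lintegral_of_indepFun
    (mV'.comp ((mX 0).prodMk (mX 1))) (mfg.comp ((mD 0).prodMk (mD 1))) (key.comp mV' mfg)
  have e2 := lintegral_mul_eq_lintegral_mul_lintegral_of_indepFun
    ((measurable_of_countable f).comp (mD 0)) ((measurable_of_countable g).comp (mD 1))
    (hD.comp (measurable_of_countable f) (measurable_of_countable g))
  simp only [Pi.mul_apply, Function.comp] at e1 e2
  rw [← hlaw, ← hlaw, ← e2]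
  exact e1

/-- The density at `T` factors at time `a`: the part up to `a` joins the weight `U` of the past, and
the rest turns the rates `μ i` of the increments into `lam i`. -/
lemma lintegral_pricingMeasure_increments {a : ℝ≥0} (ha : a ≤ M.T) {U : Ω → ℝ≥0∞}
    (hU : Measurable[M.filtration a] U) (f g : ℕ → ℝ≥0∞) :
    ∫⁻ ω, U ω * (f (M.N 0 M.T ω - M.N 0 a ω) * g (M.N 1 M.T ω - M.N 1 a ω)) ∂M.pricingMeasure
      = (∫⁻ ω, U ω * M.density a ω ∂P) *
        ((∫⁻ n, f n ∂poissonMeasure ((M.lam 0).toNNReal * (M.T - a)))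
          * ∫⁻ n, g n ∂poissonMeasure ((M.lam 1).toNNReal * (M.T - a))) := by
  have mN i t : Measurable (M.N i t) := (M.isPoisson i).measurable t
  have mU := hU.mono (M.filtration.le _) le_rfl
  have mf : Measurable fun ω => f (M.N 0 M.T ω - M.N 0 a ω) * g (M.N 1 M.T ω - M.N 1 a ω) :=
    .comp (measurable_of_countable fun x : (ℕ × ℕ) × (ℕ × ℕ) => f (x.1.1 - x.1.2) * g (x.2.1 - x.2.2))
      (((mN 0 _).prodMk (mN 0 _)).prodMk ((mN 1 _).prodMk (mN 1 _)))
  have mL := (M.measurable_density M.T).mono (M.filtration.le _) le_rfl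
  have hρ i : (0 : ℝ) ≤ M.lam i / M.μ i := div_nonneg (M.lam_pos i).le (M.μ i).2
  have hs i : (((M.lam i).toNNReal * (M.T - a) : ℝ≥0) : ℝ)
      = M.lam i / M.μ i * ((M.μ i * (M.T - a) : ℝ≥0) : ℝ) := by
    have h2 : (0 : ℝ) < M.μ i := M.μ_pos i
    push_cast
    rw [Real.coe_toNNReal _ (M.lam_pos i).le]
    field_simp
  have e := lintegral_withDensity_eq_lintegral_mul P mL (mU.mul mf)
  simp only [Pi.mul_apply] at e
  have e' := M.lintegral_mul_increments ha (hU.mul (M.measurable_density a))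
  simp only [Pi.mul_apply] at e'
  rw [pricingMeasure, e, ← lintegral_poissonMeasure_mul_pow (hρ 0) _ _ (hs 0) f,
    ← lintegral_poissonMeasure_mul_pow (hρ 1) _ _ (hs 1) g,
    ← e']
  refine lintegral_congr fun ω => ?_
  rw [M.density_mul ha, Fin.prod_univ_two]
  push_cast [NNReal.coe_sub ha]
  ring

instance : IsProbabilityMeasure M.pricingMeasure := by
  constructor
  have := M.lintegral_pricingMeasure_increments (a := 0) zero_le (U := fun _ => 1)
    measurable_const (fun _ => 1) (fun _ => 1)
  simpa [density, (M.isPoisson _).start] using this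

/-- Under the pricing measure the goal process `i` has intensity `lam i`. -/
lemma lintegral_pricingMeasure_increment (i : Fin 2) {a : ℝ≥0} (ha : a ≤ M.T) {U : Ω → ℝ≥0∞}
    (hU : Measurable[M.filtration a] U) :
    ∫⁻ ω, U ω * ((M.N i M.T ω - M.N i a ω : ℕ) : ℝ≥0∞) ∂M.pricingMeasure
      = ENNReal.ofReal (M.lam i) * ((M.T - a : ℝ≥0) : ℝ≥0∞) * ∫⁻ ω, U ω ∂M.pricingMeasure := by
  have h0 := M.lintegral_pricingMeasure_increments ha hU (fun _ => 1) (fun _ => 1)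
  simp only [mul_one, lintegral_const, measure_univ] at h0
  rw [h0, mul_comm]
  fin_cases i
  · have := M.lintegral_pricingMeasure_increments ha hU (fun n => n) (fun _ => 1)
    simpa [lintegral_poissonMeasure_id, ENNReal.ofReal] using this
  · have := M.lintegral_pricingMeasure_increments ha hU (fun _ => 1) (fun n => n)
    simpa [lintegral_poissonMeasure_id, ENNReal.ofReal] using this

end BettingModel

end

/-! ### The compensator of the goals on the predictable σ-algebra. -/

noncomputable section

lemma measurableEmbedding_coe_nnreal : MeasurableEmbedding ((↑) : ℝ≥0 → ℝ) :=
  .subtype_coe measurableSet_Ici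

lemma lebesgueTime_Ioc (a b : ℝ≥0) : lebesgueTime (Ioc a b) = ((b - a : ℝ≥0) : ℝ≥0∞) := by
  have : ((↑) : ℝ≥0 → ℝ) '' Ioc a b = Ioc (a : ℝ) b := by
    ext x
    simp only [mem_image, mem_Ioc]
    exact ⟨fun ⟨y, hy, e⟩ => e ▸ hy, fun h => ⟨⟨x, a.2.trans h.1.le⟩, h, rfl⟩⟩
  rw [lebesgueTime, measurableEmbedding_coe_nnreal.comap_apply, this,
    Real.volume_Ioc, ENNReal.ofReal]
  rfl

lemma lebesgueTime_singleton (x : ℝ≥0) : lebesgueTime {x} = 0 := by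
  rw [lebesgueTime, measurableEmbedding_coe_nnreal.comap_apply]
  simp

lemma isPiSystem_predictable {Ω : Type*} {m : MeasurableSpace Ω} (F : Filtration ℝ≥0 m) :
    IsPiSystem ({s | ∃ A, MeasurableSet[F ⊥] A ∧ s = {⊥} ×ˢ A} ∪
      {s | ∃ i A, MeasurableSet[F i] A ∧ s = Ioi i ×ˢ A}) := by
  rintro _ (⟨A, hA, rfl⟩ | ⟨i, A, hA, rfl⟩) _ (⟨B, hB, rfl⟩ | ⟨j, B, hB, rfl⟩) hne
  · exact .inl ⟨A ∩ B, hA.inter hB, by rw [prod_inter_prod, inter_self]⟩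
  · obtain ⟨⟨x, y⟩, ⟨h1, -⟩, h2, -⟩ := hne
    obtain rfl : x = ⊥ := h1
    exact absurd (mem_Ioi.1 h2) not_lt_bot
  · obtain ⟨⟨x, y⟩, ⟨h2, -⟩, h1, -⟩ := hne
    obtain rfl : x = ⊥ := h1
    exact absurd (mem_Ioi.1 h2) not_lt_bot
  · refine .inr ⟨max i j, A ∩ B, ?_, by rw [prod_inter_prod, Ioi_inter_Ioi]⟩
    exact (F.mono (le_max_left i j) _ hA).inter (F.mono (le_max_right i j) _ hB)

lemma predictable_le_prod {Ω : Type*} {m : MeasurableSpace Ω} (F : Filtration ℝ≥0 m) :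
    F.predictable ≤ Prod.instMeasurableSpace :=
  measurableSpace_le_predictable_of_measurableSet
    (fun _ hA => (measurableSet_singleton _).prod (F.le _ _ hA))
    (fun _ _ hA => measurableSet_Ioi.prod (F.le _ _ hA))

/-- Fubini with the coordinates exchanged: the kernels go from `Ω` to time, whereas processes are
functions on time × `Ω`. -/
lemma MeasureTheory.Integrable.compProd_swap {α β : Type*} [MeasurableSpace α] [MeasurableSpace β]
    {μ : Measure α} [SFinite μ] {κ : Kernel α β} [IsSFiniteKernel κ] {f : β × α → ℝ}
    (h : Integrable f ((μ ⊗ₘ κ).map Prod.swap)) :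
    Integrable (fun x => ∫ y, f (y, x) ∂κ x) μ ∧
    ∫ z, f z ∂((μ ⊗ₘ κ).map Prod.swap) = ∫ x, ∫ y, f (y, x) ∂κ x ∂μ := by
  have h' : Integrable (fun z => f z.swap) (μ ⊗ₘ κ) :=
    (integrable_map_equiv MeasurableEquiv.prodComm f).1 h
  constructor
  · exact Integrable.integral_compProd (κ := .const Unit μ) (η := .prodMkLeft Unit κ) (a := ()) h'
  · exact (integral_map_equiv MeasurableEquiv.prodComm f).trans (Measure.integral_compProd h')

namespace BettingModel

variable {Ω : Type*} [MeasurableSpace Ω] {P : Measure Ω} (M : BettingModel P)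

lemma path_measure_Ioc (i : Fin 2) (ω : Ω) (a b : ℝ≥0) :
    (M.path i ω).measure (Ioc a b) = ((M.N i b ω - M.N i a ω : ℕ) : ℝ≥0∞) := by
  rw [StieltjesFunction.measure_Ioc]
  change ENNReal.ofReal ((M.N i b ω : ℝ) - (M.N i a ω : ℝ)) = _
  rw [ENNReal.ofReal_sub _ (by positivity)]
  simp

/-- The goal times of team `i` up to time `T`, as a random measure. -/
def jumpKernel (i : Fin 2) : Kernel Ω ℝ≥0 where
  toFun ω := (M.path i ω).measure.restrict (Ioc 0 M.T)
  measurable' := by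
    have hfin ω : IsFiniteMeasure ((M.path i ω).measure.restrict (Ioc 0 M.T)) :=
      ⟨by simp⟩
    have mN t : Measurable (M.N i t) := (M.isPoisson i).measurable t
    have hm (b : ℝ≥0) : Measurable fun ω => (M.path i ω).measure (Ioc 0 b) := by
      simp_rw [path_measure_Ioc]
      exact (measurable_of_countable fun x : ℕ × ℕ => ((x.1 - x.2 : ℕ) : ℝ≥0∞)).comp
        ((mN b).prodMk (mN 0))
    -- It suffices to measure the sets `Iic x`, whose mass is a goal count at a fixed time.
    refine Measurable.measure_of_isPiSystem
      ((BorelSpace.measurable_eq (α := ℝ≥0)).trans (borel_eq_generateFrom_Iic ℝ≥0))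
      isPiSystem_Iic ?_ ?_
    · rintro _ ⟨x, rfl⟩
      have : Iic x ∩ Ioc 0 M.T = Ioc 0 (min M.T x) := by
        ext; simp; tauto
      simp_rw [Measure.restrict_apply measurableSet_Iic, this]
      exact hm _
    · simp_rw [Measure.restrict_apply .univ, univ_inter]
      exact hm _

/-- The Lebesgue measure on `(0, T]`. -/
def timeKernel : Kernel Ω ℝ≥0 := Kernel.const Ω (lebesgueTime.restrict (Ioc 0 M.T))

lemma jumpKernel_apply (i : Fin 2) (ω : Ω) :
    M.jumpKernel i ω = (M.path i ω).measure.restrict (Ioc 0 M.T) := rfl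

lemma timeKernel_apply (ω : Ω) : M.timeKernel ω = lebesgueTime.restrict (Ioc 0 M.T) := rfl

lemma jumpKernel_Ioi (i : Fin 2) (ω : Ω) (a : ℝ≥0) :
    M.jumpKernel i ω (Ioi a) = ((M.N i M.T ω - M.N i a ω : ℕ) : ℝ≥0∞) := by
  rw [← path_measure_Ioc]
  change (M.path i ω).measure.restrict (Ioc 0 M.T) (Ioi a) = _
  rw [Measure.restrict_apply measurableSet_Ioi, inter_comm, Ioc_inter_Ioi]
  simp

lemma timeKernel_Ioi (ω : Ω) (a : ℝ≥0) :
    M.timeKernel ω (Ioi a) = ((M.T - a : ℝ≥0) : ℝ≥0∞) := by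
  rw [← lebesgueTime_Ioc]
  change lebesgueTime.restrict (Ioc 0 M.T) (Ioi a) = _
  rw [Measure.restrict_apply measurableSet_Ioi, inter_comm, Ioc_inter_Ioi]
  simp

lemma jumpKernel_bot (i : Fin 2) (ω : Ω) : M.jumpKernel i ω {⊥} = 0 := by
  change (M.path i ω).measure.restrict (Ioc 0 M.T) {⊥} = _
  rw [Measure.restrict_apply (measurableSet_singleton _)]
  rw [show {⊥} ∩ Ioc 0 M.T = ∅ by ext; simp +contextual, measure_empty]

lemma timeKernel_bot (ω : Ω) : M.timeKernel ω {⊥} = 0 := by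
  change lebesgueTime.restrict (Ioc 0 M.T) {⊥} = _
  rw [Measure.restrict_apply (measurableSet_singleton _)]
  rw [show {⊥} ∩ Ioc 0 M.T = ∅ by ext; simp +contextual, measure_empty]

instance : IsFiniteKernel M.timeKernel := by
  have : IsFiniteMeasure (lebesgueTime.restrict (Ioc 0 M.T)) := ⟨by simp [lebesgueTime_Ioc]⟩
  unfold timeKernel
  infer_instance

/-- The total mass `N i T` is finite but not uniformly bounded in `ω`, so the kernel is split along
the events `N i T = n`. -/
instance (i : Fin 2) : IsSFiniteKernel (M.jumpKernel i) := by
  classical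
  have hm (n : ℕ) : MeasurableSet {ω | M.N i M.T ω = n} :=
    (M.isPoisson i).measurable M.T (measurableSet_singleton n)
  let κ (n : ℕ) : Kernel Ω ℝ≥0 := Kernel.piecewise (hm n) (M.jumpKernel i) 0
  have hκ (n : ℕ) : IsFiniteKernel (κ n) := by
    refine ⟨n, by simp, fun ω => ?_⟩
    rw [Kernel.piecewise_apply]
    split_ifs with h
    · change (M.path i ω).measure.restrict (Ioc 0 M.T) univ ≤ _
      rw [Measure.restrict_apply_univ, path_measure_Ioc, ← (h : _ = _)]
      exact_mod_cast Nat.sub_le _ _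
    · simp
  have : M.jumpKernel i = Kernel.sum κ := by
    ext ω s hs
    rw [Kernel.sum_apply' _ _ hs, tsum_eq_single (M.N i M.T ω)]
    · simp [κ, Kernel.piecewise_apply]
    · intro n hn
      simp [κ, Kernel.piecewise_apply, hn.symm]
  rw [this]
  infer_instance

variable [IsProbabilityMeasure P]

/-- The measure `dQ dN^i` on `(0, T] × Ω`, where `Q` is the pricing measure. -/
def jumpMeasure (i : Fin 2) : Measure (ℝ≥0 × Ω) :=
  (M.pricingMeasure ⊗ₘ M.jumpKernel i).map Prod.swap

/-- The measure `dQ dt` on `(0, T] × Ω`, where `Q` is the pricing measure. -/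
def timeMeasure : Measure (ℝ≥0 × Ω) :=
  (M.pricingMeasure ⊗ₘ M.timeKernel).map Prod.swap

instance : IsFiniteMeasure M.timeMeasure := by
  unfold timeMeasure
  infer_instance

/-- The compensator of the goal process `i` under the pricing measure is `lam i * t`. -/
lemma trim_jumpMeasure (i : Fin 2) :
    (M.jumpMeasure i).trim (predictable_le_prod M.filtration)
      = (ENNReal.ofReal (M.lam i) • M.timeMeasure).trim (predictable_le_prod M.filtration) := by
  have hI (a : ℝ≥0) (A : Set Ω) (hA : MeasurableSet[M.filtration a] A) :
      M.jumpMeasure i (Ioi a ×ˢ A) = (ENNReal.ofReal (M.lam i) • M.timeMeasure) (Ioi a ×ˢ A) := by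
    have hA' := M.filtration.le _ _ hA
    rw [jumpMeasure, Measure.smul_apply, timeMeasure,
      Measure.map_apply measurable_swap (measurableSet_Ioi.prod hA'),
      Measure.map_apply measurable_swap (measurableSet_Ioi.prod hA'), preimage_swap_prod,
      Measure.compProd_apply_prod hA' measurableSet_Ioi,
      Measure.compProd_apply_prod hA' measurableSet_Ioi]
    simp_rw [jumpKernel_Ioi, timeKernel_Ioi]
    rcases le_total a M.T with h | h
    · have := M.lintegral_pricingMeasure_increment i h (U := A.indicator 1)
        (Measurable.indicator (@measurable_const _ _ _ (M.filtration a) 1) hA)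
      rw [lintegral_indicator_one hA'] at this
      rw [setLIntegral_const, smul_eq_mul, ← mul_assoc, ← this, ← lintegral_indicator hA']
      refine lintegral_congr fun ω => ?_
      by_cases hω : ω ∈ A <;> simp [hω]
    · have (ω : Ω) : M.N i M.T ω - M.N i a ω = 0 :=
        Nat.sub_eq_zero_of_le ((M.isPoisson i).monotone ω h)
      simp [this, tsub_eq_zero_of_le h]
  have hbot (A : Set Ω) (hA : MeasurableSet A) : M.jumpMeasure i ({⊥} ×ˢ A) = 0 ∧
      (ENNReal.ofReal (M.lam i) • M.timeMeasure) ({⊥} ×ˢ A) = 0 := by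
    have h := (measurableSet_singleton (⊥ : ℝ≥0)).prod hA
    rw [jumpMeasure, Measure.smul_apply, timeMeasure, Measure.map_apply measurable_swap h,
      Measure.map_apply measurable_swap h, preimage_swap_prod,
      Measure.compProd_apply_prod hA (measurableSet_singleton _),
      Measure.compProd_apply_prod hA (measurableSet_singleton _)]
    simp only [jumpKernel_bot, timeKernel_bot, lintegral_zero, smul_zero, and_self]
  have huniv : M.jumpMeasure i univ = (ENNReal.ofReal (M.lam i) • M.timeMeasure) univ := by
    have : (univ : Set (ℝ≥0 × Ω)) = {⊥} ×ˢ univ ∪ Ioi 0 ×ˢ univ := by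
      ext x
      simp only [mem_univ, mem_union, mem_prod, mem_singleton_iff, mem_Ioi, and_true, true_iff]
      exact eq_bot_or_bot_lt x.1
    have hd : Disjoint ({⊥} ×ˢ univ : Set (ℝ≥0 × Ω)) (Ioi 0 ×ˢ univ) := by
      rw [Set.disjoint_prod]
      left
      simp
    rw [this, measure_union hd (measurableSet_Ioi.prod .univ),
      measure_union hd (measurableSet_Ioi.prod .univ), (hbot _ .univ).1, (hbot _ .univ).2,
      hI 0 _ .univ]
  -- Finiteness, needed for the uniqueness of measures on a π-system, is inherited from
  -- `timeMeasure`.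
  have hfin : IsFiniteMeasure (M.jumpMeasure i) := ⟨by
    rw [huniv, Measure.smul_apply, smul_eq_mul]
    finiteness⟩
  refine @Measure.ext _ M.filtration.predictable _ _ fun s hs => ?_
  rw [trim_measurableSet_eq _ hs, trim_measurableSet_eq _ hs]
  refine ext_on_measurableSpace_of_generate_finite _ _ ?_ (predictable_le_prod M.filtration) rfl
    (isPiSystem_predictable M.filtration) huniv hs
  rintro _ (⟨A, hA, rfl⟩ | ⟨a, A, hA, rfl⟩)
  · have := hbot A (M.filtration.le _ _ hA)
    rw [this.1, this.2]
  · exact hI a A hA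

/-- Predictable integrands that are integrable with respect to time have integrals of mean zero
with respect to the assets, under the pricing measure. -/
lemma integral_pricingMeasure_eq {H : ℝ≥0 → Ω → ℝ} (hH : IsStronglyPredictable M.filtration H)
    (hi : Integrable (Function.uncurry H) M.timeMeasure) (i : Fin 2) :
    Integrable (fun ω => M.assetIntegral i (fun s => H s ω) M.T ω) M.pricingMeasure ∧
    ∫ ω, M.assetIntegral i (fun s => H s ω) M.T ω ∂M.pricingMeasure = 0 := by
  have hle := predictable_le_prod M.filtration
  have hi2 : Integrable (Function.uncurry H) (ENNReal.ofReal (M.lam i) • M.timeMeasure) :=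
    hi.smul_measure (by simp)
  -- Predictability of `H` is what allows passing to the trimmed measures, where the two measures
  -- coincide.
  have hi1 : Integrable (Function.uncurry H) (M.jumpMeasure i) := by
    refine integrable_of_integrable_trim hle ?_
    rw [trim_jumpMeasure]
    exact hi2.trim hle hH
  have heq : ∫ x, Function.uncurry H x ∂M.jumpMeasure i
      = M.lam i * ∫ x, Function.uncurry H x ∂M.timeMeasure := by
    rw [integral_trim hle hH, trim_jumpMeasure, ← integral_trim hle hH, integral_smul_measure,
      ENNReal.toReal_ofReal (M.lam_pos i).le, smul_eq_mul]
  obtain ⟨l1, h1⟩ := hi1.compProd_swap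
  obtain ⟨l2, h2⟩ := hi.compProd_swap
  simp only [Function.uncurry_apply_pair] at l1 h1 l2 h2
  have e (ω : Ω) : M.assetIntegral i (fun s => H s ω) M.T ω
      = (∫ s, H s ω ∂M.jumpKernel i ω) - M.lam i * ∫ s, H s ω ∂M.timeKernel ω := by
    rw [assetIntegral, jumpKernel_apply, timeKernel_apply]
  simp_rw [e]
  refine ⟨l1.sub (l2.const_mul _), ?_⟩
  rw [integral_sub l1 (l2.const_mul _), integral_const_mul]
  exact sub_eq_zero.2 (h1.symm.trans (heq.trans (congrArg _ h2)))

end BettingModel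

end

/-! ### Predictability of running integrals and the times at which they pass a level. -/

noncomputable section

section Predictable

variable {Ω : Type*} {m : MeasurableSpace Ω} (F : Filtration ℝ≥0 m)

lemma measurable_fst_predictable : Measurable[F.predictable] (Prod.fst : ℝ≥0 × Ω → ℝ≥0) := by
  rw [BorelSpace.measurable_eq (α := ℝ≥0), borel_eq_generateFrom_Ioi]
  refine @measurable_generateFrom _ _ F.predictable _ _ ?_
  rintro _ ⟨a, rfl⟩
  have := measurableSet_predictable_Ioi_prod (𝓕 := F) (i := a) (s := univ) .univ
  rwa [prod_univ] at this

/-- For a generator `(a, ∞) × A` the length is the positive part of `x.1 - a` on `A`, which is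
predictable; generators at time `0` contribute nothing. The π-λ theorem does the rest. -/
lemma measurable_predictable_volume_slice {S : Set (ℝ≥0 × Ω)} (hS : MeasurableSet[F.predictable] S) :
    Measurable[F.predictable] fun x : ℝ≥0 × Ω =>
      lebesgueTime (Ioc 0 x.1 ∩ {u | (u, x.2) ∈ S}) := by
  have hslice {S : Set (ℝ≥0 × Ω)} (hS : MeasurableSet[F.predictable] S) (ω : Ω) :
      MeasurableSet {u | (u, ω) ∈ S} :=
    (predictable_le_prod F _ hS).preimage (measurable_id.prodMk measurable_const)
  induction S, hS using MeasurableSpace.induction_on_inter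
    (show F.predictable = MeasurableSpace.generateFrom _ from rfl) (isPiSystem_predictable F) with
  | empty => simp
  | basic S hS =>
    rcases hS with ⟨A, hA, rfl⟩ | ⟨a, A, hA, rfl⟩
    · have (x : ℝ≥0 × Ω) : Ioc 0 x.1 ∩ {u | (u, x.2) ∈ ({⊥} : Set ℝ≥0) ×ˢ A} = ∅ := by
        ext u
        simp only [mem_inter_iff, mem_Ioc, mem_ofPred_eq, mem_prod, mem_singleton_iff,
          mem_empty_iff_false, iff_false, not_and]
        rintro ⟨h, -⟩ rfl
        exact absurd h (lt_irrefl _)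
      simp only [this, measure_empty]
      exact measurable_const
    · have (x : ℝ≥0 × Ω) : lebesgueTime (Ioc 0 x.1 ∩ {u | (u, x.2) ∈ Ioi a ×ˢ A})
          = (Ioi a ×ˢ A).indicator (fun x => ((x.1 - a : ℝ≥0) : ℝ≥0∞)) x := by
        by_cases hA : x.2 ∈ A
        · have h : Ioc 0 x.1 ∩ {u | (u, x.2) ∈ Ioi a ×ˢ A} = Ioc a x.1 := by
            ext u
            simp only [mem_inter_iff, mem_Ioc, mem_ofPred_eq, mem_prod, mem_Ioi, hA, and_true]
            exact ⟨fun h => ⟨h.2, h.1.2⟩, fun h => ⟨⟨zero_le.trans_lt h.1, h.2⟩, h.1⟩⟩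
          rw [h, lebesgueTime_Ioc]
          by_cases hx : a < x.1
          · rw [indicator_of_mem (show x ∈ Ioi a ×ˢ A from ⟨hx, hA⟩)]
          · rw [indicator_of_notMem (fun h => hx h.1), tsub_eq_zero_of_le (not_lt.1 hx)]
            simp
        · rw [indicator_of_notMem (fun h => hA h.2)]
          simp [hA]
      simp_rw [this]
      refine Measurable.indicator ?_ (measurableSet_predictable_Ioi_prod hA)
      exact (measurable_coe_nnreal_ennreal.comp (measurable_id.sub_const a)).comp
        (measurable_fst_predictable F)
  | compl S hS ih =>
    have (x : ℝ≥0 × Ω) : lebesgueTime (Ioc 0 x.1 ∩ {u | (u, x.2) ∈ Sᶜ})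
        = (x.1 : ℝ≥0∞) - lebesgueTime (Ioc 0 x.1 ∩ {u | (u, x.2) ∈ S}) := by
      have h := measure_inter_add_sdiff (μ := lebesgueTime) (Ioc 0 x.1) (hslice hS x.2)
      rw [lebesgueTime_Ioc, tsub_zero] at h
      rw [← h, ENNReal.add_sub_cancel_left]
      · rfl
      · refine ((measure_mono inter_subset_left).trans_lt ?_).ne
        rw [lebesgueTime_Ioc]
        exact ENNReal.coe_lt_top
    simp_rw [this]
    exact Measurable.sub (measurable_coe_nnreal_ennreal.comp (measurable_fst_predictable F)) ih
  | iUnion S hd hS ih =>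
    have (x : ℝ≥0 × Ω) : lebesgueTime (Ioc 0 x.1 ∩ {u | (u, x.2) ∈ ⋃ k, S k})
        = ∑' k, lebesgueTime (Ioc 0 x.1 ∩ {u | (u, x.2) ∈ S k}) := by
      rw [← measure_iUnion, ← inter_iUnion]
      · congr 2
        ext u
        simp
      · intro i j hij
        refine Set.disjoint_left.2 fun u hu hv => ?_
        exact Set.disjoint_left.1 (hd hij) hu.2 hv.2
      · exact fun k => measurableSet_Ioc.inter (hslice (hS k) x.2)
    simp_rw [this]
    exact @Measurable.tsum _ ℝ≥0∞ _ F.predictable _ _ _ _ _ _ _ _ _ _ _ _ ih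

/-- The running integral of a predictable process is predictable. -/
lemma measurable_predictable_lintegral {f : ℝ≥0 × Ω → ℝ≥0∞} (hf : Measurable[F.predictable] f) :
    Measurable[F.predictable] fun x : ℝ≥0 × Ω =>
      ∫⁻ u in Ioc 0 x.1, f (u, x.2) ∂lebesgueTime := by
  have hslice {f : ℝ≥0 × Ω → ℝ≥0∞} (hf : Measurable[F.predictable] f) (ω : Ω) :
      Measurable fun u => f (u, ω) :=
    (hf.mono (predictable_le_prod F) le_rfl).comp (measurable_id.prodMk measurable_const)
  refine @Measurable.ennreal_induction _ F.predictable (fun f => Measurable[F.predictable]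
    fun x : ℝ≥0 × Ω => ∫⁻ u in Ioc 0 x.1, f (u, x.2) ∂lebesgueTime) ?_ ?_ ?_ f hf
  · intro c S hS
    have hS' (ω : Ω) : MeasurableSet {u | (u, ω) ∈ S} :=
      (predictable_le_prod F _ hS).preimage (measurable_id.prodMk measurable_const)
    have (x : ℝ≥0 × Ω) : ∫⁻ u in Ioc 0 x.1, S.indicator (fun _ => c) (u, x.2) ∂lebesgueTime
        = c * lebesgueTime (Ioc 0 x.1 ∩ {u | (u, x.2) ∈ S}) := by
      rw [inter_comm, ← Measure.restrict_apply (hS' x.2), ← lintegral_indicator_const (hS' x.2)]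
      rfl
    simp_rw [this]
    exact Measurable.const_mul (measurable_predictable_volume_slice F hS) c
  · intro f g _ hf hg ihf ihg
    simp_rw [Pi.add_apply, lintegral_add_left (hslice hf _)]
    exact Measurable.add ihf ihg
  · intro f hf hm ih
    have (x : ℝ≥0 × Ω) : ∫⁻ u in Ioc 0 x.1, ⨆ n, f n (u, x.2) ∂lebesgueTime
        = ⨆ n, ∫⁻ u in Ioc 0 x.1, f n (u, x.2) ∂lebesgueTime :=
      lintegral_iSup (fun n => hslice (hf n) _) fun i j hij u => hm hij _
    simp_rw [this]
    exact Measurable.iSup ih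

end Predictable

/-- The running integral of a nonnegative function first exceeds the level `n` after a time `σ`. -/
lemma exists_forall_lintegral_le_iff (f : ℝ≥0 → ℝ≥0∞) (t : ℝ≥0) (n : ℝ≥0∞) :
    ∃ σ ≤ t, ∀ u, (u ≤ t ∧ ∫⁻ v in Ioc 0 u, f v ∂lebesgueTime ≤ n) ↔ u ≤ σ := by
  set A : ℝ≥0 → ℝ≥0∞ := fun u => ∫⁻ v in Ioc 0 u, f v ∂lebesgueTime with hA
  have hmono : Monotone A := fun u v h =>
    lintegral_mono_set (Ioc_subset_Ioc_right h)
  set D := {u | u ≤ t ∧ A u ≤ n} with hD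
  have h0 : (0 : ℝ≥0) ∈ D := ⟨zero_le, by simp [hA]⟩
  have hb : BddAbove D := ⟨t, fun u hu => hu.1⟩
  have hσt : sSup D ≤ t := csSup_le ⟨0, h0⟩ fun u hu => hu.1
  -- The supremum belongs to `D` because `A` is left-continuous: `(0, sSup D)` is an increasing
  -- union of intervals ending in points of `D`, and the endpoint is a null set. No finiteness of
  -- `A` beyond `sSup D` is needed.
  have hσ : A (sSup D) ≤ n := by
    rcases eq_zero_or_pos (sSup D) with h | h
    · rw [h]; exact h0.2
    obtain ⟨u, hu, hul, hut⟩ := exists_seq_strictMono_tendsto' h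
    have hun (k : ℕ) : A (u k) ≤ n := by
      obtain ⟨v, hv, hkv⟩ := exists_lt_of_lt_csSup ⟨0, h0⟩ (hul k).2
      exact (hmono hkv.le).trans hv.2
    have hU : Ioo 0 (sSup D) = ⋃ k, Ioc 0 (u k) := by
      ext x
      simp only [mem_Ioo, mem_iUnion, mem_Ioc]
      constructor
      · rintro ⟨hx0, hx⟩
        obtain ⟨k, hk⟩ := (hut.eventually_const_lt hx).exists
        exact ⟨k, hx0, hk.le⟩
      · rintro ⟨k, hx0, hx⟩
        exact ⟨hx0, hx.trans_lt (hul k).2⟩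
    have hae : (Ioc 0 (sSup D) : Set ℝ≥0) =ᵐ[lebesgueTime] Ioo 0 (sSup D) :=
      (Ioo_ae_eq_Ioc' (lebesgueTime_singleton _)).symm
    change ∫⁻ v in Ioc 0 (sSup D), f v ∂lebesgueTime ≤ n
    rw [setLIntegral_congr hae, hU, setLIntegral_iUnion_of_directed]
    · exact iSup_le hun
    · exact Monotone.directed_le fun i j h => Ioc_subset_Ioc_right (hu.monotone h)
  refine ⟨sSup D, hσt, fun u => ⟨fun h => le_csSup hb h, fun h => ⟨h.trans hσt, ?_⟩⟩⟩
  exact (hmono h).trans hσ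

end

/-! ### Right-continuity of gains, localization and absence of arbitrage. -/

noncomputable section

namespace BettingModel

open Filter Topology

variable {Ω : Type*} [MeasurableSpace Ω] {P : Measure Ω} (M : BettingModel P)

/-- A right-continuous integer-valued path is constant just after `s`, so the jump integral does not
change there, whatever `f` is. The time integral converges by dominated convergence. -/
lemma tendsto_assetIntegral_right (i : Fin 2) (ω : Ω) {f : ℝ≥0 → ℝ} {s t : ℝ≥0} (hst : s < t)
    (hf : IntegrableOn f (Ioc 0 t) lebesgueTime) :
    Tendsto (fun u => M.assetIntegral i f u ω) (𝓝[>] s) (𝓝 (M.assetIntegral i f s ω)) := by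
  refine Tendsto.sub ?_ (Tendsto.const_mul _ ?_)
  · have h1 : ∀ᶠ u in 𝓝[>] s, M.N i u ω = M.N i s ω := by
      have := ((M.isPoisson i).rightContinuous ω s).mono Ioi_subset_Ici_self
      exact this (isOpen_discrete {M.N i s ω} |>.mem_nhds rfl)
    refine tendsto_const_nhds.congr' ?_
    filter_upwards [h1, self_mem_nhdsWithin] with u hu hsu
    refine setIntegral_congr_set ?_
    refine (LE.le.eventuallyLE (Ioc_subset_Ioc_right (le_of_lt hsu))).antisymm ?_
    refine ae_le_set.2 ?_
    have : Ioc 0 u \ Ioc 0 s = Ioc s u := by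
      ext x
      simp only [Set.mem_sdiff, mem_Ioc, not_and, not_le]
      exact ⟨fun h => ⟨h.2 h.1.1, h.1.2⟩, fun h => ⟨⟨zero_le.trans_lt h.1, h.2⟩, fun _ => h.1⟩⟩
    rw [this, path_measure_Ioc, hu]
    simp
  · have e (u : ℝ≥0) (hu : u ≤ t) : ∫ x in Ioc 0 u, f x ∂lebesgueTime
        = ∫ x in Ioc 0 t, (Iic u).indicator f x ∂lebesgueTime := by
      rw [setIntegral_indicator measurableSet_Iic, Ioc_inter_Iic, min_eq_right hu]
    rw [e s hst.le]
    have : ∀ᶠ u in 𝓝[>] s, ∫ x in Ioc 0 t, (Iic u).indicator f x ∂lebesgueTime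
        = ∫ x in Ioc 0 u, f x ∂lebesgueTime := by
      filter_upwards [Ioo_mem_nhdsGT hst] with u hu using (e u hu.2.le).symm
    refine Tendsto.congr' this ?_
    refine tendsto_integral_filter_of_dominated_convergence (fun x => ‖f x‖)
      (.of_forall fun u => hf.1.indicator measurableSet_Iic)
      (.of_forall fun u => .of_forall fun x => norm_indicator_le_norm_self _ _) hf.norm
      (.of_forall fun x => ?_)
    rcases le_or_gt x s with hx | hx
    · refine tendsto_const_nhds.congr' ?_
      filter_upwards [self_mem_nhdsWithin] with u hu
      rw [indicator_of_mem (show x ∈ Iic s from hx),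
        indicator_of_mem (show x ∈ Iic u from hx.trans (le_of_lt hu))]
    · rw [indicator_of_notMem (show x ∉ Iic s from not_le.2 hx)]
      refine tendsto_const_nhds.congr' ?_
      filter_upwards [Ioo_mem_nhdsGT hx] with u hu
      rw [indicator_of_notMem (show x ∉ Iic u from not_le.2 hu.2)]

lemma assetIntegral_indicator_Iic (i : Fin 2) (ω : Ω) (f : ℝ≥0 → ℝ) {σ t : ℝ≥0} (h : σ ≤ t) :
    M.assetIntegral i ((Iic σ).indicator f) t ω = M.assetIntegral i f σ ω := by
  simp_rw [assetIntegral, setIntegral_indicator measurableSet_Iic, Ioc_inter_Iic, min_eq_right h]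

/-- The sum of the pathwise integrals of a strategy against the two risky assets. -/
def tradingIntegral (φ : Fin 3 → ℝ≥0 → Ω → ℝ) (t : ℝ≥0) (ω : Ω) : ℝ :=
  M.assetIntegral 0 (fun s => φ 1 s ω) t ω + M.assetIntegral 1 (fun s => φ 2 s ω) t ω

variable {M}

lemma IsSelfFinancing.ae_gain_eq {φ : Fin 3 → ℝ≥0 → Ω → ℝ} (h : M.IsSelfFinancing φ) :
    ∀ᵐ ω ∂P, ∀ t ≤ M.T, M.gain φ t ω = M.tradingIntegral φ t ω := by
  filter_upwards [h.value_eq] with ω hω t ht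
  rw [gain, tradingIntegral, hω t ht]
  ring

lemma IsTradingStrategy.measurable_gain {φ : Fin 3 → ℝ≥0 → Ω → ℝ} (h : M.IsTradingStrategy φ)
    (t : ℝ≥0) : Measurable (M.gain φ t) := by
  have mφ i t : Measurable (φ i t) :=
    ((h.predictable i).stronglyAdapted t).measurable.mono (M.filtration.le _) le_rfl
  have mS i t : Measurable (M.asset i t) :=
    .add_const ((measurable_of_countable fun n : ℕ => (n : ℝ)).comp
      ((M.isPoisson i).measurable t)) _
  have mV t : Measurable (M.value φ t) :=
    .add (.add (.mul (mφ 0 t) measurable_const) (.mul (mφ 1 t) (mS 0 t))) (.mul (mφ 2 t) (mS 1 t))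
  exact (mV t).sub (mV 0)

/-- A lower bound at each time holds along almost every path. -/
lemma IsSelfFinancing.ae_forall_le {φ : Fin 3 → ℝ≥0 → Ω → ℝ} (h : M.IsSelfFinancing φ) {t : ℝ≥0}
    (ht : t ≤ M.T) {c : ℝ} (hc : ∀ s ≤ t, ∀ᵐ ω ∂P, c ≤ M.gain φ s ω) :
    ∀ᵐ ω ∂P, ∀ s ≤ t, c ≤ M.tradingIntegral φ s ω := by
  obtain ⟨D, hDc, hD⟩ := TopologicalSpace.exists_countable_dense ℝ≥0
  have h1 : ∀ᵐ ω ∂P, ∀ s ∈ D, s ≤ t → c ≤ M.gain φ s ω := by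
    refine (ae_ball_iff hDc).2 fun s _ => ?_
    by_cases hs : s ≤ t
    · filter_upwards [hc s hs] with ω hω _ using hω
    · exact .of_forall fun ω h => absurd h hs
  filter_upwards [h1, hc t le_rfl, h.ae_gain_eq, h.integrable 1, h.integrable 2]
    with ω h1 h2 h3 i1 i2 s hs
  rcases hs.eq_or_lt with rfl | hst
  · rw [← h3 s ht]; exact h2
  -- A value below `c` at `s` would persist on an interval to the right of `s`, which contains a
  -- time of the countable dense set.
  by_contra! hlt
  have hi {f : ℝ≥0 → ℝ} (hf : IntegrableOn f (Icc 0 M.T) lebesgueTime) :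
      IntegrableOn f (Ioc 0 t) lebesgueTime :=
    hf.mono_set (Ioc_subset_Icc_self.trans (Icc_subset_Icc_right ht))
  have hlim : Tendsto (fun u => M.tradingIntegral φ u ω) (𝓝[>] s)
      (𝓝 (M.tradingIntegral φ s ω)) :=
    (M.tendsto_assetIntegral_right 0 ω hst (hi i1)).add
      (M.tendsto_assetIntegral_right 1 ω hst (hi i2))
  obtain ⟨u, hu, hsub⟩ := mem_nhdsGT_iff_exists_Ioo_subset.1
    (inter_mem (hlim.eventually_lt_const hlt) (Ioo_mem_nhdsGT hst))
  obtain ⟨d, hd, hdu⟩ := hD.exists_mem_open isOpen_Ioo (nonempty_Ioo.2 hu)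
  obtain ⟨hd1, hd2⟩ := hsub hdu
  have := h1 d hd hd2.2.le
  rw [h3 d (hd2.2.le.trans ht)] at this
  exact absurd this (not_le.2 hd1)

variable [IsProbabilityMeasure P]

/-- The gain of a self-financing strategy, stopped when the running integral of its positions
exceeds `n`, has mean zero under the pricing measure. -/
lemma IsSelfFinancing.exists_localization {φ : Fin 3 → ℝ≥0 → Ω → ℝ} (h : M.IsSelfFinancing φ)
    {t : ℝ≥0} (ht : t ≤ M.T) :
    ∃ (G : ℕ → Ω → ℝ), (∀ n, Integrable (G n) M.pricingMeasure) ∧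
      (∀ n, ∫ ω, G n ω ∂M.pricingMeasure = 0) ∧
      (∀ n ω, ∃ σ ≤ t, G n ω = M.tradingIntegral φ σ ω) ∧
      ∀ᵐ ω ∂P, ∀ᶠ n in atTop, G n ω = M.tradingIntegral φ t ω := by
  set f : ℝ≥0 × Ω → ℝ≥0∞ := fun x => ‖φ 1 x.1 x.2‖ₑ + ‖φ 2 x.1 x.2‖ₑ with hf
  have mf : Measurable[M.filtration.predictable] f :=
    Measurable.add (h.predictable 1).enorm (h.predictable 2).enorm
  have mA := measurable_predictable_lintegral M.filtration mf
  set A : ℝ≥0 → Ω → ℝ≥0∞ := fun s ω => ∫⁻ u in Ioc 0 s, f (u, ω) ∂lebesgueTime with hA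
  choose σ hσt hσ using fun (n : ℕ) (ω : Ω) =>
    exists_forall_lintegral_le_iff (fun u => f (u, ω)) t n
  -- Cutting off with this predictable set equals stopping at `σ n`, and makes any separate
  -- measurability statement for `σ n` unnecessary.
  let D (n : ℕ) : Set (ℝ≥0 × Ω) := {x | x.1 ≤ t ∧ A x.1 x.2 ≤ n}
  have mD (n : ℕ) : MeasurableSet[M.filtration.predictable] (D n) := by
    refine MeasurableSet.inter ?_ ?_
    · exact (measurable_fst_predictable M.filtration) measurableSet_Iic
    · exact mA measurableSet_Iic
  let H (n : ℕ) (j : Fin 3) (s : ℝ≥0) (ω : Ω) : ℝ := (D n).indicator (Function.uncurry (φ j)) (s, ω)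
  have hH (n : ℕ) (j : Fin 3) (ω : Ω) :
      (fun s => H n j s ω) = (Iic (σ n ω)).indicator fun s => φ j s ω := by
    ext s
    by_cases hs : s ≤ σ n ω
    · rw [indicator_of_mem (show s ∈ Iic (σ n ω) from hs)]
      exact indicator_of_mem (show (s, ω) ∈ D n from (hσ n ω s).2 hs) _
    · rw [indicator_of_notMem (show s ∉ Iic (σ n ω) from hs)]
      exact indicator_of_notMem (show (s, ω) ∉ D n from fun h => hs ((hσ n ω s).1 h)) _
  have pH (n : ℕ) (j : Fin 3) : IsStronglyPredictable M.filtration (H n j) :=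
    (h.predictable j).indicator (mD n)
  have iH (n : ℕ) (j : Fin 3) (hj : ∀ x, ‖φ j x.1 x.2‖ₑ ≤ f x) :
      Integrable (Function.uncurry (H n j)) M.timeMeasure := by
    have sm := (pH n j).mono (predictable_le_prod M.filtration)
    refine ⟨sm.aestronglyMeasurable, ?_⟩
    have sm' : Measurable fun x : ℝ≥0 × Ω => ‖Function.uncurry (H n j) x‖ₑ := sm.enorm
    rw [hasFiniteIntegral_iff_enorm, timeMeasure, lintegral_map sm' measurable_swap]
    refine (Measure.lintegral_compProd (sm'.comp measurable_swap)).trans_lt ?_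
    -- On every path the running integral at `σ n ω` is at most `n`, and Q has total mass one.
    refine (lintegral_mono (g := fun _ => (n : ℝ≥0∞)) fun ω => ?_).trans_lt ?_
    · rw [timeKernel_apply]
      simp only [Function.comp]
      have e (s : ℝ≥0) : ‖Function.uncurry (H n j) (ω, s).swap‖ₑ
          ≤ (Iic (σ n ω)).indicator (fun s => f (s, ω)) s := by
        have := congrFun (hH n j ω) s
        simp only [Prod.swap_prod_mk, Function.uncurry_apply_pair, this]
        by_cases hs : s ∈ Iic (σ n ω)
        · rw [indicator_of_mem hs, indicator_of_mem hs]; exact hj (s, ω)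
        · rw [indicator_of_notMem hs, indicator_of_notMem hs]; simp
      refine (lintegral_mono e).trans ?_
      rw [lintegral_indicator measurableSet_Iic, Measure.restrict_restrict measurableSet_Iic,
        inter_comm, Ioc_inter_Iic, min_eq_right ((hσt n ω).trans ht)]
      exact ((hσ n ω _).2 le_rfl).2
    · simp
  have key1 n := integral_pricingMeasure_eq M (pH n 1) (iH n 1 fun x => le_self_add) 0
  have key2 n := integral_pricingMeasure_eq M (pH n 2) (iH n 2 fun x => le_add_self) 1
  refine ⟨fun n ω => M.assetIntegral 0 (fun s => H n 1 s ω) M.T ω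
    + M.assetIntegral 1 (fun s => H n 2 s ω) M.T ω, fun n => (key1 n).1.add (key2 n).1,
    fun n => ?_, fun n ω => ⟨σ n ω, hσt n ω, ?_⟩, ?_⟩
  · rw [integral_add (key1 n).1 (key2 n).1, (key1 n).2, (key2 n).2, add_zero]
  · beta_reduce
    rw [hH, hH, assetIntegral_indicator_Iic _ _ _ _ ((hσt n ω).trans ht),
      assetIntegral_indicator_Iic _ _ _ _ ((hσt n ω).trans ht), tradingIntegral]
  · filter_upwards [h.integrable 1, h.integrable 2] with ω i1 i2
    have hfin : A t ω < ∞ := by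
      have hi {f : ℝ≥0 → ℝ} (hf : IntegrableOn f (Icc 0 M.T) lebesgueTime) :
          IntegrableOn f (Ioc 0 t) lebesgueTime :=
        hf.mono_set (Ioc_subset_Icc_self.trans (Icc_subset_Icc_right ht))
      have : A t ω = ∫⁻ u in Ioc 0 t, ‖φ 1 u ω‖ₑ ∂lebesgueTime
          + ∫⁻ u in Ioc 0 t, ‖φ 2 u ω‖ₑ ∂lebesgueTime :=
        lintegral_add_left' (hi i1).1.enorm _
      rw [this]
      exact ENNReal.add_lt_top.2 ⟨(hi i1).2, (hi i2).2⟩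
    obtain ⟨n₀, hn₀⟩ := ENNReal.exists_nat_gt hfin.ne
    filter_upwards [eventually_ge_atTop n₀] with n hn
    have : σ n ω = t := le_antisymm (hσt n ω)
      ((hσ n ω t).1 ⟨le_rfl, hn₀.le.trans (by exact_mod_cast hn)⟩)
    rw [hH, hH, this, assetIntegral_indicator_Iic _ _ _ _ ht,
      assetIntegral_indicator_Iic _ _ _ _ ht, tradingIntegral]

theorem isArbitrageFree (M : BettingModel P) : M.IsArbitrageFree := by
  rintro ⟨φ, h, t, ht, ⟨c, hc⟩, hnn, hpos⟩
  obtain ⟨G, iG, G0, Gσ, hG⟩ := h.exists_localization ht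
  set Q := M.pricingMeasure
  have hQ := M.pricingMeasure_ac
  have hlow : ∀ᵐ ω ∂Q, ∀ s ≤ t, -c ≤ M.tradingIntegral φ s ω := hQ (h.ae_forall_le ht hc)
  have hnn' : ∀ᵐ ω ∂P, 0 ≤ M.gain φ t ω :=
    (mem_ae_iff_prob_eq_one (measurableSet_le measurable_const (h.measurable_gain t))).2 hnn
  have heq := h.ae_gain_eq
  have hI : ∀ᵐ ω ∂Q, 0 ≤ M.tradingIntegral φ t ω := hQ (by
    filter_upwards [hnn', heq] with ω h1 h2
    rwa [← h2 t ht])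
  have mI : AEMeasurable (M.tradingIntegral φ t) Q :=
    (h.measurable_gain t).aemeasurable.congr (hQ (by filter_upwards [heq] with ω hω using hω t ht))
  have mcG (n : ℕ) : AEMeasurable (fun ω => ENNReal.ofReal (G n ω + c)) Q :=
    ((iG n).1.aemeasurable.add_const c).ennreal_ofReal
  -- `G n` is the gain at a random time `s ≤ t`; the pathwise bound `hlow` makes `G n + c`
  -- nonnegative, so `ENNReal.ofReal` loses nothing.
  have hlint (n : ℕ) : ∫⁻ ω, ENNReal.ofReal (G n ω + c) ∂Q = ENNReal.ofReal c := by
    rw [← ofReal_integral_eq_lintegral_ofReal (f := fun ω => G n ω + c)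
      ((iG n).add (integrable_const c))]
    · rw [integral_add (iG n) (integrable_const c), G0]
      simp
    · filter_upwards [hlow] with ω hω
      obtain ⟨s, hs, e⟩ := Gσ n ω
      have := hω s hs
      simp only [Pi.zero_apply]
      linarith
  have hfatou : ∫⁻ ω, ENNReal.ofReal (M.tradingIntegral φ t ω + c) ∂Q ≤ ENNReal.ofReal c := by
    calc _ ≤ ∫⁻ ω, liminf (fun n => ENNReal.ofReal (G n ω + c)) atTop ∂Q := by
          refine lintegral_mono_ae ?_
          filter_upwards [hQ hG] with ω hω
          refine (Tendsto.liminf_eq ?_).ge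
          refine tendsto_const_nhds.congr' ?_
          filter_upwards [hω] with n hn
          rw [hn]
      _ ≤ _ := (lintegral_liminf_le' mcG).trans (by simp [hlint])
  have hle : (fun _ => ENNReal.ofReal c) ≤ᵐ[Q]
      fun ω => ENNReal.ofReal (M.tradingIntegral φ t ω + c) := by
    filter_upwards [hI] with ω hω
    exact ENNReal.ofReal_le_ofReal (by linarith)
  -- The gain at time `0` is `0`, so the bound there forces `c` to be nonnegative.
  have hc0 : 0 ≤ c := by
    have : ∀ᵐ ω ∂P, -c ≤ (0 : ℝ) := by
      filter_upwards [hc 0 zero_le] with ω hω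
      simpa [gain] using hω
    obtain ⟨-, h⟩ := this.exists
    linarith
  -- The gain plus `c` is at least `c` but has integral at most `c`, hence equals `c` almost
  -- everywhere.
  have hae := ae_eq_of_ae_le_of_lintegral_le hle (by simp) (mI.add_const c).ennreal_ofReal
    (by simpa using hfatou)
  have hzero : ∀ᵐ ω ∂P, M.gain φ t ω ≤ 0 := by
    filter_upwards [M.ac_pricingMeasure hae, M.ac_pricingMeasure hI, heq] with ω h1 h2 h3
    rw [h3 t ht]
    have h1 : ENNReal.ofReal c = ENNReal.ofReal (M.tradingIntegral φ t ω + c) := h1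
    rw [ENNReal.ofReal_eq_ofReal_iff hc0 (by positivity)] at h1
    linarith
  refine hpos.ne' (measure_mono_null (fun ω hω => ?_) (ae_iff.1 hzero))
  exact not_le.2 hω

end BettingModel

end

/-! ### Predictable step processes and a grid of times increasing to `T`. -/

noncomputable section

section StepProcess

variable {Ω : Type*} {m : MeasurableSpace Ω} (F : Filtration ℝ≥0 m)

lemma measurable_predictable_indicator_Ioi {i : ℝ≥0} {c : Ω → ℝ} (hc : Measurable[F i] c) :
    Measurable[F.predictable] ((Ioi i ×ˢ univ).indicator fun x : ℝ≥0 × Ω => c x.2) := by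
  have hI := measurableSet_predictable_Ioi_prod (𝓕 := F) (i := i) (s := univ) .univ
  intro B hB
  have h : (Ioi i ×ˢ univ).indicator (fun x : ℝ≥0 × Ω => c x.2) ⁻¹' B
      = (Ioi i ×ˢ (c ⁻¹' B)) ∪ ((fun _ : ℝ≥0 × Ω => (0 : ℝ)) ⁻¹' B \ Ioi i ×ˢ univ) := by
    ext x
    by_cases hx : x ∈ Ioi i ×ˢ (univ : Set Ω)
    · have hx1 : i < x.1 := hx.1
      simp [hx1]
    · have hx1 : ¬ i < x.1 := fun h => hx ⟨h, trivial⟩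
      simp [hx1]
  rw [h]
  exact MeasurableSet.union (measurableSet_predictable_Ioi_prod (hc hB))
    (MeasurableSet.diff (@measurable_const _ _ _ F.predictable 0 _ hB) hI)

/-- The process with the value `c k` on the interval `(t k, t (k + 1)]`. -/
def stepProcess (t : ℕ → ℝ≥0) (c : ℕ → Ω → ℝ) (s : ℝ≥0) (ω : Ω) : ℝ :=
  ∑' k, (Ioc (t k) (t (k + 1))).indicator (fun _ => c k ω) s

lemma isStronglyPredictable_stepProcess {t : ℕ → ℝ≥0} {c : ℕ → Ω → ℝ}
    (hc : ∀ k, Measurable[F (t k)] (c k)) : IsStronglyPredictable F (stepProcess t c) := by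
  refine (?_ : Measurable[F.predictable] _).stronglyMeasurable
  refine @Measurable.tsum _ ℝ _ F.predictable _ _ _ _ _ _ _ _ _ _ _ _ fun k => ?_
  have h : (fun x : ℝ≥0 × Ω => (Ioc (t k) (t (k + 1))).indicator (fun _ => c k x.2) x.1)
      = {x | x.1 ≤ t (k + 1)}.indicator ((Ioi (t k) ×ˢ univ).indicator fun x => c k x.2) := by
    ext x
    by_cases h1 : t k < x.1 <;> by_cases h2 : x.1 ≤ t (k + 1) <;> simp [indicator, h1, h2]
  rw [h]
  exact Measurable.indicator (measurable_predictable_indicator_Ioi F (hc k))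
    (measurable_fst_predictable F measurableSet_Iic)

lemma stepProcess_eq {t : ℕ → ℝ≥0} (ht : StrictMono t) (c : ℕ → Ω → ℝ) {k : ℕ} {s : ℝ≥0}
    (hs : s ∈ Ioc (t k) (t (k + 1))) (ω : Ω) : stepProcess t c s ω = c k ω := by
  rw [stepProcess, tsum_eq_single k]
  · exact indicator_of_mem hs _
  · intro j hj
    refine indicator_of_notMem (fun h => ?_) _
    rcases lt_or_gt_of_ne hj with hlt | hlt
    · exact absurd (h.2.trans (ht.monotone hlt)) (not_le.2 hs.1)
    · exact absurd (hs.2.trans (ht.monotone hlt)) (not_le.2 h.1)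

lemma stepProcess_eq_zero {t : ℕ → ℝ≥0} (c : ℕ → Ω → ℝ) {s : ℝ≥0}
    (hs : ∀ k, s ∉ Ioc (t k) (t (k + 1))) (ω : Ω) : stepProcess t c s ω = 0 := by
  simp [stepProcess, hs]

end StepProcess

lemma integrableOn_Ioc_extend {μ : Measure ℝ≥0} {f : ℝ≥0 → ℝ} {s s' : ℝ≥0} {a : ℝ}
    (hss : s ≤ s') (hμ : μ (Ioc s s') ≠ ∞) (hf : IntegrableOn f (Ioc 0 s) μ)
    (ha : ∀ u ∈ Ioc s s', f u = a) :
    IntegrableOn f (Ioc 0 s') μ ∧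
      ∫ u in Ioc 0 s', f u ∂μ = ∫ u in Ioc 0 s, f u ∂μ + a * μ.real (Ioc s s') := by
  have h2 : IntegrableOn f (Ioc s s') μ :=
    (integrableOn_const (C := a) hμ).congr_fun (fun u hu => (ha u hu).symm) measurableSet_Ioc
  rw [← Ioc_union_Ioc_eq_Ioc (zero_le (a := s)) hss]
  refine ⟨hf.union h2, ?_⟩
  rw [setIntegral_union (Ioc_disjoint_Ioc_of_le le_rfl) measurableSet_Ioc hf h2,
    setIntegral_congr_fun measurableSet_Ioc ha, setIntegral_const, smul_eq_mul, mul_comm a]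

/-- Times that increase to `T`, starting from `0`. -/
def timeGrid (T : ℝ≥0) (k : ℕ) : ℝ≥0 := T * (k / (k + 1))

section TimeGrid

variable {T : ℝ≥0}

lemma timeGrid_zero : timeGrid T 0 = 0 := by simp [timeGrid]

lemma tendsto_timeGrid : Filter.Tendsto (timeGrid T) Filter.atTop (nhds T) := by
  have h : Filter.Tendsto (fun k : ℕ => (k / (k + 1) : ℝ≥0)) Filter.atTop (nhds 1) := by
    rw [← NNReal.tendsto_coe]
    push_cast
    exact tendsto_natCast_div_add_atTop 1
  simpa [timeGrid] using! h.const_mul T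

lemma strictMono_timeGrid (hT : 0 < T) : StrictMono (timeGrid T) := by
  refine strictMono_nat_of_lt_succ fun k => ?_
  refine mul_lt_mul_of_pos_left ?_ hT
  rw [div_lt_div_iff₀ (by positivity) (by positivity), ← NNReal.coe_lt_coe]
  push_cast
  nlinarith

lemma timeGrid_lt (hT : 0 < T) (k : ℕ) : timeGrid T k < T :=
  (strictMono_timeGrid hT k.lt_succ_self).trans_le
    ((strictMono_timeGrid hT).monotone.ge_of_tendsto tendsto_timeGrid _)

lemma exists_mem_Ioc_timeGrid {s : ℝ≥0} (h0 : 0 < s) (hs : s < T) :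
    ∃ k, s ∈ Ioc (timeGrid T k) (timeGrid T (k + 1)) := by
  classical
  have hex : ∃ k, s ≤ timeGrid T k :=
    ((tendsto_timeGrid.eventually_const_lt hs).exists).imp fun _ h => h.le
  obtain ⟨k, hk⟩ : ∃ k, Nat.find hex = k + 1 := Nat.exists_eq_succ_of_ne_zero fun h => by
    have := Nat.find_spec hex
    rw [h, timeGrid_zero] at this
    exact absurd this (not_le.2 h0)
  exact ⟨k, not_le.1 (Nat.find_min hex (m := k) (by omega)), hk ▸ Nat.find_spec hex⟩

end TimeGrid

/-! ### Replication of every bet by chasing its value. -/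

namespace BettingModel

open Filter Topology

variable {Ω : Type*} [MeasurableSpace Ω] {P : Measure Ω} (M : BettingModel P)

/-- Extending the integration range over an interval on which the integrand is constant. -/
lemma assetIntegral_extend (i : Fin 2) (ω : Ω) {f : ℝ≥0 → ℝ} {s s' : ℝ≥0} {a : ℝ} (hss : s ≤ s')
    (h1 : IntegrableOn f (Ioc 0 s) (M.path i ω).measure)
    (h2 : IntegrableOn f (Ioc 0 s) lebesgueTime) (ha : ∀ u ∈ Ioc s s', f u = a) :
    IntegrableOn f (Ioc 0 s') (M.path i ω).measure ∧ IntegrableOn f (Ioc 0 s') lebesgueTime ∧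
      M.assetIntegral i f s' ω = M.assetIntegral i f s ω
        + a * (M.asset i s' ω - M.asset i s ω) := by
  have e1 := integrableOn_Ioc_extend hss (by simp) h1 ha
  have e2 := integrableOn_Ioc_extend hss (by simp [lebesgueTime_Ioc]) h2 ha
  refine ⟨e1.1, e2.1, ?_⟩
  have hN := (M.isPoisson i).monotone ω hss
  rw [assetIntegral, e1.2, e2.2, assetIntegral, Measure.real, Measure.real, path_measure_Ioc,
    lebesgueTime_Ioc, asset, asset]
  simp only [ENNReal.toReal_natCast, ENNReal.coe_toReal, NNReal.coe_sub hss]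
  push_cast [Nat.cast_sub (show M.N i s ω ≤ M.N i s' ω from hN)]
  ring

/-- The value that a bet would have if no more goals were scored after time `s`. -/
lemma exists_adapted_of_measurable {X : Ω → ℝ} (hX : Measurable[M.filtration M.T] X) :
    ∃ Y : ℝ≥0 → Ω → ℝ, (∀ s, Measurable[M.filtration s] (Y s)) ∧
      ∀ s ≤ M.T, ∀ ω, (∀ i, M.N i M.T ω = M.N i s ω) → Y s ω = X ω := by
  rw [filtration_eq_comap] at hX
  obtain ⟨g, hg, rfl⟩ := hX.exists_eq_measurable_comp
  refine ⟨fun s ω => g fun u => (M.N 0 (min u s) ω, M.N 1 (min u s) ω), fun s => ?_,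
    fun s hs ω h => ?_⟩
  · refine hg.comp (@measurable_pi_lambda _ _ _ (M.filtration s) _ _ fun u => ?_)
    exact Measurable.prodMk (M.measurable_N 0 (min_le_right _ _))
      (M.measurable_N 1 (min_le_right _ _))
  · have e (i : Fin 2) (u : Iic M.T) : M.N i (min u s) ω = M.N i u ω := by
      have hmono := (M.isPoisson i).monotone ω
      refine le_antisymm (hmono (min_le_left _ _)) ?_
      rcases le_total (u : ℝ≥0) s with hu | hu
      · rw [min_eq_left hu]
      · rw [min_eq_right hu, ← h i]
        exact hmono u.2
    simp only [Function.comp, e]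

/-- Almost surely no goal is scored shortly before or at time `T`. -/
lemma ae_exists_forall_N_eq : ∀ᵐ ω ∂P, ∃ k, ∀ i, M.N i M.T ω = M.N i (timeGrid M.T k) ω := by
  rw [ae_iff]
  -- The exceptional event is contained, for each `k`, in the event of a goal in `(t_k, T]`. By
  -- Markov's inequality at level `1` the latter has probability at most the sum of the `μ i * (T -
  -- t_k)`, which tends to `0`.
  have hsub (k : ℕ) : {ω | ¬ ∃ k, ∀ i, M.N i M.T ω = M.N i (timeGrid M.T k) ω} ⊆
      ⋃ i, {ω | 1 ≤ ((M.N i M.T ω - M.N i (timeGrid M.T k) ω : ℕ) : ℝ≥0∞)} := by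
    intro ω hω
    simp only [mem_ofPred_eq, not_exists, not_forall] at hω
    obtain ⟨i, hi⟩ := hω k
    refine mem_iUnion.2 ⟨i, ?_⟩
    have := (M.isPoisson i).monotone ω (timeGrid_lt M.T_pos k).le
    have h1 : 1 ≤ M.N i M.T ω - M.N i (timeGrid M.T k) ω := by
      simp only at this
      omega
    exact_mod_cast h1
  have hle (k : ℕ) : P {ω | ¬ ∃ k, ∀ i, M.N i M.T ω = M.N i (timeGrid M.T k) ω} ≤
      ((∑ i, M.μ i * (M.T - timeGrid M.T k) : ℝ≥0) : ℝ≥0∞) := by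
    refine (measure_mono (hsub k)).trans ((measure_iUnion_fintype_le _ _).trans ?_)
    rw [ENNReal.ofNNReal_finsetSum]
    refine Finset.sum_le_sum fun i _ => ?_
    have mN : Measurable fun ω => M.N i M.T ω - M.N i (timeGrid M.T k) ω :=
      (measurable_of_countable fun x : ℕ × ℕ => x.1 - x.2).comp
        (((M.isPoisson i).measurable _).prodMk ((M.isPoisson i).measurable _))
    have h := mul_meas_ge_le_lintegral (μ := P)
      ((measurable_of_countable fun n : ℕ => (n : ℝ≥0∞)).comp mN) 1
    rw [one_mul] at h
    refine h.trans ?_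
    simp only [Function.comp]
    rw [← lintegral_map (μ := P) (measurable_of_countable fun n : ℕ => (n : ℝ≥0∞)) mN,
      (M.isPoisson i).law_increment _ _ (timeGrid_lt M.T_pos k).le, lintegral_poissonMeasure_id]
  have hlim : Tendsto (fun k => ((∑ i, M.μ i * (M.T - timeGrid M.T k) : ℝ≥0) : ℝ≥0∞)) atTop
      (𝓝 0) := by
    rw [← ENNReal.coe_zero, ENNReal.tendsto_coe]
    have : Tendsto (fun k => ∑ i, M.μ i * (M.T - timeGrid M.T k)) atTop
        (𝓝 (∑ i, M.μ i * (M.T - M.T))) :=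
      tendsto_finsetSum _ fun i _ => (tendsto_const_nhds.sub tendsto_timeGrid).const_mul _
    simpa using this
  exact le_antisymm (ge_of_tendsto' hlim hle) zero_le

/-- The portfolio value at the times of the grid, when over each interval of the grid the value `Y`
is aimed at for the case that no goal is scored. -/
def chasingValue (Y : ℝ≥0 → Ω → ℝ) : ℕ → Ω → ℝ
  | 0, _ => 0
  | k + 1, ω => chasingValue Y k ω + (chasingValue Y k ω - Y (timeGrid M.T k) ω)
      / (M.lam 0 * (timeGrid M.T (k + 1) - timeGrid M.T k))
      * (M.asset 0 (timeGrid M.T (k + 1)) ω - M.asset 0 (timeGrid M.T k) ω)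

/-- The number of units of the first risky asset held over the `k`-th interval of the grid. -/
def chasingStake (Y : ℝ≥0 → Ω → ℝ) (k : ℕ) (ω : Ω) : ℝ :=
  (M.chasingValue Y k ω - Y (timeGrid M.T k) ω)
    / (M.lam 0 * (timeGrid M.T (k + 1) - timeGrid M.T k))

lemma chasingValue_succ (Y : ℝ≥0 → Ω → ℝ) (k : ℕ) (ω : Ω) :
    M.chasingValue Y (k + 1) ω = M.chasingValue Y k ω + M.chasingStake Y k ω *
      (M.asset 0 (timeGrid M.T (k + 1)) ω - M.asset 0 (timeGrid M.T k) ω) := rfl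

/-- Without a goal of team `0` the asset falls by exactly `lam 0` times the length of the interval,
the denominator of the stake, so the distance to `Y` is lost in full. -/
lemma chasingValue_succ_of_eq (Y : ℝ≥0 → Ω → ℝ) {k : ℕ} {ω : Ω}
    (h : M.N 0 (timeGrid M.T (k + 1)) ω = M.N 0 (timeGrid M.T k) ω) :
    M.chasingValue Y (k + 1) ω = Y (timeGrid M.T k) ω := by
  have h1 : (0 : ℝ) < timeGrid M.T (k + 1) - timeGrid M.T k :=
    sub_pos.2 (NNReal.coe_lt_coe.2 (strictMono_timeGrid M.T_pos k.lt_succ_self))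
  have h2 := M.lam_pos 0
  rw [chasingValue_succ, chasingStake, asset, asset, h]
  field_simp
  ring

lemma measurable_asset (i : Fin 2) {s t : ℝ≥0} (h : s ≤ t) :
    Measurable[M.filtration t] (M.asset i s) :=
  Measurable.add_const ((measurable_of_countable fun n : ℕ => (n : ℝ)).comp (M.measurable_N i h)) _

lemma measurable_chasingValue {Y : ℝ≥0 → Ω → ℝ} (hY : ∀ s, Measurable[M.filtration s] (Y s))
    (k : ℕ) : Measurable[M.filtration (timeGrid M.T k)] (M.chasingValue Y k) := by
  induction k with
  | zero => exact measurable_const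
  | succ k ih =>
    have hle := (strictMono_timeGrid M.T_pos).monotone k.le_succ
    have ih' := ih.mono (M.filtration.mono hle) le_rfl
    have hY' := (hY (timeGrid M.T k)).mono (M.filtration.mono hle) le_rfl
    exact Measurable.add ih' (Measurable.mul (Measurable.div_const (Measurable.sub ih' hY') _)
      (Measurable.sub (M.measurable_asset 0 le_rfl) (M.measurable_asset 0 hle)))

lemma measurable_chasingStake {Y : ℝ≥0 → Ω → ℝ} (hY : ∀ s, Measurable[M.filtration s] (Y s))
    (k : ℕ) : Measurable[M.filtration (timeGrid M.T k)] (M.chasingStake Y k) :=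
  Measurable.div_const (Measurable.sub (M.measurable_chasingValue hY k) (hY _)) _

/-- The strategy that holds `chasingStake` units of the first risky asset and keeps the rest of its
value in the bond. -/
def chasingStrategy (Y : ℝ≥0 → Ω → ℝ) : Fin 3 → ℝ≥0 → Ω → ℝ :=
  ![fun s ω => stepProcess (timeGrid M.T) (fun k ω => M.chasingValue Y k ω
      - M.chasingStake Y k ω * M.asset 0 (timeGrid M.T k) ω) s ω
      -- At `T`, which lies in no interval of the grid, the bond position is the limit of the grid
      -- values. Each term is the indicator of times after `t_k` times an `F_{t_k}`-measurable
      -- variable, so the limsup is predictable.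
      + {x : ℝ≥0 × Ω | M.T ≤ x.1}.indicator (fun x => limsup (fun k =>
        (Ioi (timeGrid M.T k) ×ˢ univ).indicator
          (fun x : ℝ≥0 × Ω => M.chasingValue Y k x.2) x) atTop) (s, ω),
    stepProcess (timeGrid M.T) (M.chasingStake Y),
    fun _ _ => 0]

lemma isStronglyPredictable_chasingStrategy {Y : ℝ≥0 → Ω → ℝ}
    (hY : ∀ s, Measurable[M.filtration s] (Y s)) (j : Fin 3) :
    IsStronglyPredictable M.filtration (M.chasingStrategy Y j) := by
  fin_cases j
  · refine StronglyMeasurable.add (isStronglyPredictable_stepProcess _ fun k => ?_) ?_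
    · exact Measurable.sub (M.measurable_chasingValue hY k)
        (Measurable.mul (M.measurable_chasingStake hY k) (M.measurable_asset 0 le_rfl))
    · refine (?_ : Measurable[M.filtration.predictable] _).stronglyMeasurable
      refine Measurable.indicator ?_ (measurable_fst_predictable M.filtration measurableSet_Ici)
      exact Measurable.limsup fun k =>
        measurable_predictable_indicator_Ioi M.filtration (M.measurable_chasingValue hY k)
  · exact isStronglyPredictable_stepProcess _ (M.measurable_chasingStake hY)
  · exact @stronglyMeasurable_const _ _ M.filtration.predictable _ 0

lemma chasingStrategy_of_mem (Y : ℝ≥0 → Ω → ℝ) {k : ℕ} {s : ℝ≥0}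
    (hs : s ∈ Ioc (timeGrid M.T k) (timeGrid M.T (k + 1))) (ω : Ω) :
    M.chasingStrategy Y 0 s ω
        = M.chasingValue Y k ω - M.chasingStake Y k ω * M.asset 0 (timeGrid M.T k) ω ∧
      M.chasingStrategy Y 1 s ω = M.chasingStake Y k ω := by
  have hT : ¬ M.T ≤ s := not_le.2 (hs.2.trans_lt (timeGrid_lt M.T_pos _))
  refine ⟨?_, stepProcess_eq (strictMono_timeGrid M.T_pos) _ hs ω⟩
  simp only [chasingStrategy, Matrix.cons_val_zero]
  rw [stepProcess_eq (strictMono_timeGrid M.T_pos) _ hs,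
    indicator_of_notMem (show (s, ω) ∉ {x : ℝ≥0 × Ω | M.T ≤ x.1} from hT), add_zero]

lemma chasingStrategy_zero (Y : ℝ≥0 → Ω → ℝ) (ω : Ω) :
    M.chasingStrategy Y 0 0 ω = 0 ∧ M.chasingStrategy Y 1 0 ω = 0 := by
  have hs (c : ℕ → Ω → ℝ) : stepProcess (timeGrid M.T) c 0 ω = 0 :=
    stepProcess_eq_zero c (fun k h => absurd h.1 (not_lt.2 zero_le)) ω
  refine ⟨?_, hs _⟩
  simp only [chasingStrategy, Matrix.cons_val_zero]
  rw [hs, indicator_of_notMem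
    (show ((0 : ℝ≥0), ω) ∉ {x : ℝ≥0 × Ω | M.T ≤ x.1} from not_le.2 M.T_pos), add_zero]

lemma chasingStrategy_T {Y : ℝ≥0 → Ω → ℝ} {ω : Ω} {x : ℝ}
    (h : ∀ᶠ k in atTop, M.chasingValue Y k ω = x) :
    M.chasingStrategy Y 0 M.T ω = x ∧ M.chasingStrategy Y 1 M.T ω = 0 := by
  have hs (c : ℕ → Ω → ℝ) : stepProcess (timeGrid M.T) c M.T ω = 0 :=
    stepProcess_eq_zero c (fun k h => absurd h.2 (not_le.2 (timeGrid_lt M.T_pos _))) ω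
  refine ⟨?_, hs _⟩
  simp only [chasingStrategy, Matrix.cons_val_zero]
  rw [hs, indicator_of_mem (show (M.T, ω) ∈ {x : ℝ≥0 × Ω | M.T ≤ x.1} from le_refl M.T), zero_add]
  refine (Tendsto.limsup_eq (tendsto_const_nhds.congr' ?_))
  filter_upwards [h] with k hk
  rw [indicator_of_mem (show (M.T, ω) ∈ Ioi (timeGrid M.T k) ×ˢ univ from
    ⟨timeGrid_lt M.T_pos k, trivial⟩), hk]

lemma chasingStrategy_integral (Y : ℝ≥0 → Ω → ℝ) (ω : Ω) (k : ℕ) :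
    IntegrableOn (fun s => M.chasingStrategy Y 0 s ω) (Ioc 0 (timeGrid M.T k)) lebesgueTime ∧
    IntegrableOn (fun s => M.chasingStrategy Y 1 s ω) (Ioc 0 (timeGrid M.T k))
      (M.path 0 ω).measure ∧
    IntegrableOn (fun s => M.chasingStrategy Y 1 s ω) (Ioc 0 (timeGrid M.T k)) lebesgueTime ∧
    M.assetIntegral 0 (fun s => M.chasingStrategy Y 1 s ω) (timeGrid M.T k) ω
      = M.chasingValue Y k ω := by
  induction k with
  | zero => simp [timeGrid_zero, assetIntegral, chasingValue]
  | succ k ih =>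
    obtain ⟨i0, i1, i2, e⟩ := ih
    have hle := (strictMono_timeGrid M.T_pos).monotone k.le_succ
    have h := M.assetIntegral_extend 0 ω hle i1 i2
      fun u hu => (M.chasingStrategy_of_mem Y hu ω).2
    refine ⟨(integrableOn_Ioc_extend hle (by simp [lebesgueTime_Ioc]) i0
      fun u hu => (M.chasingStrategy_of_mem Y hu ω).1).1, h.1, h.2.1, ?_⟩
    rw [h.2.2, e, chasingValue_succ]

theorem isComplete (M : BettingModel P) : M.IsComplete := by
  intro X hX
  obtain ⟨Y, mY, hY⟩ := M.exists_adapted_of_measurable hX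
  set φ := M.chasingStrategy Y with hφ
  set t := timeGrid M.T with ht
  have tmono : StrictMono t := strictMono_timeGrid M.T_pos
  have tlt (k) : t k < M.T := timeGrid_lt M.T_pos k
  have hφ2 (s ω) : φ 2 s ω = 0 := rfl
  have h0 (ω) : M.value φ 0 ω = 0 := by
    have := M.chasingStrategy_zero Y ω
    rw [value, hφ2, hφ, this.1, this.2]
    ring
  have hgood : ∀ᵐ ω ∂P, IntegrableOn (fun s => φ 0 s ω) (Ioc 0 M.T) lebesgueTime ∧
      IntegrableOn (fun s => φ 1 s ω) (Ioc 0 M.T) lebesgueTime ∧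
      M.assetIntegral 0 (fun s => φ 1 s ω) M.T ω = X ω ∧ M.value φ M.T ω = X ω := by
    filter_upwards [M.ae_exists_forall_N_eq] with ω ⟨K, hK⟩
    have hN (i : Fin 2) {k : ℕ} (hk : K ≤ k) : M.N i M.T ω = M.N i (t k) ω := by
      have hm := (M.isPoisson i).monotone ω
      exact le_antisymm ((hK i).le.trans (hm (tmono.monotone hk))) (hm (tlt k).le)
    have hYX {k : ℕ} (hk : K ≤ k) : Y (t k) ω = X ω := hY _ (tlt k).le ω fun i => hN i hk
    -- The target `Y (t k)` is the bet from `k = K` on, but it is reached only at the end of the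
    -- interval, hence `K + 1`.
    have hV {k : ℕ} (hk : K + 1 ≤ k) : M.chasingValue Y k ω = X ω := by
      obtain ⟨k, rfl⟩ := Nat.exists_eq_succ_of_ne_zero (show k ≠ 0 by omega)
      rw [M.chasingValue_succ_of_eq Y, hYX (by omega)]
      exact (hN 0 (by omega)).symm.trans (hN 0 (by omega))
    have ha {k : ℕ} (hk : K + 1 ≤ k) : M.chasingStake Y k ω = 0 := by
      rw [chasingStake, hV hk, hYX (by omega), sub_self, zero_div]
    have hT := M.chasingStrategy_T (Y := Y) (x := X ω)
      ((eventually_ge_atTop (K + 1)).mono fun k hk => hV hk)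
    -- After `t (K + 1)` everything is in the bond. The infinitely many remaining intervals thus act
    -- as a single one with constant positions, and integrability up to `T` follows.
    have hlast : ∀ u ∈ Ioc (t (K + 1)) M.T, φ 0 u ω = X ω ∧ φ 1 u ω = 0 := by
      intro u hu
      rcases hu.2.eq_or_lt with rfl | huT
      · exact hT
      · obtain ⟨k, hk⟩ := exists_mem_Ioc_timeGrid (zero_le.trans_lt hu.1) huT
        have hKk : K + 1 ≤ k := Nat.lt_succ_iff.1 (tmono.lt_iff_lt.1 (hu.1.trans_le hk.2))
        have := M.chasingStrategy_of_mem Y hk ω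
        rw [ha hKk, hV hKk, zero_mul, sub_zero] at this
        exact this
    obtain ⟨i0, i1, i2, e⟩ := M.chasingStrategy_integral Y ω (K + 1)
    have h := M.assetIntegral_extend 0 ω (tlt (K + 1)).le i1 i2 fun u hu => (hlast u hu).2
    refine ⟨(integrableOn_Ioc_extend (tlt (K + 1)).le (by simp [lebesgueTime_Ioc]) i0
      fun u hu => (hlast u hu).1).1, h.2.1, ?_, ?_⟩
    · rw [h.2.2, e, hV le_rfl, zero_mul, add_zero]
    · rw [value, hφ2, hφ, hT.1, hT.2, bond]
      ring
  have hIcc {f : ℝ≥0 → ℝ} (hf : IntegrableOn f (Ioc 0 M.T) lebesgueTime) :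
      IntegrableOn f (Icc 0 M.T) lebesgueTime :=
    (integrableOn_Icc_iff_integrableOn_Ioc' (by simp [lebesgueTime_singleton])).2 hf
  refine ⟨φ, ⟨⟨M.isStronglyPredictable_chasingStrategy mY, fun j => ?_⟩, ?_⟩, ?_⟩
  · fin_cases j
    · filter_upwards [hgood] with ω hω using hIcc hω.1
    · filter_upwards [hgood] with ω hω using hIcc hω.2.1
    · exact .of_forall fun ω => integrableOn_zero
  · filter_upwards [hgood] with ω ⟨_, _, hI, hVT⟩ s hs
    have hz : M.assetIntegral 1 (fun s => φ 2 s ω) s ω = 0 := by simp [hφ2, assetIntegral]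
    rw [h0, hz, zero_add, add_zero]
    rcases hs.eq_or_lt with rfl | hsT
    · rw [hI, hVT]
    rcases eq_zero_or_pos s with rfl | hs0
    · rw [h0]
      simp [assetIntegral]
    obtain ⟨k, hk⟩ := exists_mem_Ioc_timeGrid hs0 hsT
    obtain ⟨-, i1, i2, e⟩ := M.chasingStrategy_integral Y ω k
    have h := (M.assetIntegral_extend 0 ω hk.1.le i1 i2 fun u hu =>
      (M.chasingStrategy_of_mem Y ⟨hu.1, hu.2.trans hk.2⟩ ω).2).2.2
    have hv := M.chasingStrategy_of_mem Y hk ω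
    rw [h, e, value, hφ2, hφ, hv.1, hv.2, bond]
    ring
  · filter_upwards [hgood] with ω hω using hω.2.2.2.symm

end BettingModel

end

theorem mainTheorem2 {Ω : Type*} [MeasurableSpace Ω] (P : Measure Ω) [IsProbabilityMeasure P]
    (M : BettingModel P) : M.IsArbitrageFree ∧ M.IsComplete :=
  ⟨M.isArbitrageFree, M.isComplete⟩
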